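/- Let $\Pi_\ell,\Pi_{\mathrm e}\subset\mathbb R^2$ be independent homogeneous Poisson point processes (legitimate nodes and eavesdroppers) with densities $\lambda_\ell>0$ and $\lambda_{\mathrm e}>0$. Let $P>0$ (transmit power), $\sigma^2>0$ (noise power, the same for legitimate nodes and eavesdroppers), and let $g:(0,\infty)\to\mathbb R$ be continuous and strictly decreasing with $g(r)\to0$ as $r\to\infty$. The Poisson $i\mathcal S$-graph (threshold $\varrho=0$, path loss only) is the random directed graph with vertex set $\Pi_\ell$ in which, for distinct $x,y\in\Pi_\ell$, there is an edge $\overrightarrow{xy}$ if and only if the maximum secrecy rate $$\mathcal R_{\mathrm s}(x,y)=\Big[\log_2\Big(1+\tfrac{P\,g(|x-y|)}{\sigma^2}\Big)-\log_2\Big(1+\tfrac{P\,g(|x-e^*|)}{\sigma^2}\Big)\Big]^+,\qquad e^*=\operatorname*{argmax}_{e\in\Pi_{\mathrm e}}P\,g(|x-e|),$$ is positive. Let $N_{\mathrm{in}}(x)$ be the in-degree of $x$, and call $x$ in-isolated if no edge enters it. "Typical node" is understood in the sense of Palm theory: a quantity $F(x)$ attached to the nodes $x\in\Pi_\ell$ has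 mean $$\frac1{\lambda_\ell|B|}\,\mathbb E\Big\{\sum_{x\in\Pi_\ell\cap B}F(x)\Big\}$$ at the typical node, where $B\subset\mathbb R^2$ is a Borel set with $0<|B|<\infty$ (the value being the same for all such $B$). Let $\widetilde\Pi$ be a homogeneous Poisson process of unit density in $\mathbb R^2$, and let $\widetilde A$ be the area of its typical Voronoi cell, i.e. of $$\mathcal C_0=\{y\in\mathbb R^2: |y|<|y-z| \text{ for all } z\in\widetilde\Pi\setminus\{0\}\}.$$ Then: 1. $\mathbb E\{\widetilde A\}=1$. 2. The average in-degree of a typical node is $\mathbb E\{N_{\mathrm{in}}\}=\lambda_\ell/\lambda_{\mathrm e}$. 3. The probability that a typical node is in-isolated is $p_{\text{in-isol}}=\mathbb E\{e^{-(\lambda_\ell/\lambda_{\mathrm e})\widetilde A}\}$. The equalities 2 and 3 hold as well with the typical node replaced by the node $0$ in the $i\mathcal S$-graph with legitimate nodes $\Pi_\ell\cup\{0\}$ and eavesdroppers $\Pi_{\mathrm e}$. -/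

import Mathlib

open MeasureTheory ProbabilityTheory Set Filter Topology
open scoped ENNReal NNReal

/-! ### Homogeneous Poisson point processes in the plane -/

/-- The Euclidean plane `ℝ²`. -/
abbrev Plane : Type := EuclideanSpace ℝ (Fin 2)

/-- A random set of points `X` (a map from the sample space to sets of points in the plane) is a
homogeneous Poisson point process of density `lam`: the number of points in each Borel set is a
random variable, it is Poisson distributed with mean `lam * area` for Borel sets of finite area,
and the numbers of points in pairwise disjoint Borel sets are independent. -/
structure IsPoissonProcess {Ω : Type*} [MeasurableSpace Ω] (P : Measure Ω) (lam : ℝ≥0)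
    (X : Ω → Set Plane) : Prop where
  measurable_count : ∀ B : Set Plane, MeasurableSet B → Measurable fun ω => (X ω ∩ B).encard
  hasLaw_count : ∀ B : Set Plane, MeasurableSet B → volume B ≠ ∞ →
    HasLaw (fun ω => (X ω ∩ B).encard)
      ((poissonMeasure (lam * (volume B).toNNReal)).map (fun n : ℕ => (n : ℕ∞))) P
  indep_count : ∀ (n : ℕ) (B : Fin n → Set Plane), (∀ i, MeasurableSet (B i)) →
    Pairwise (fun i j => Disjoint (B i) (B j)) →
    iIndepFun (fun i ω => (X ω ∩ B i).encard) P

/-- The σ-algebra on point configurations generated by all the counts `S ↦ #(S ∩ B)`,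
`B` Borel. -/
noncomputable abbrev countSigmaAlgebra : MeasurableSpace (Set Plane) :=
  ⨆ B : {B : Set Plane // MeasurableSet B},
    MeasurableSpace.comap (fun S : Set Plane => (S ∩ B.1).encard) inferInstance

/-- Two point processes are independent. -/
def IndepPointProcesses {Ω : Type*} [MeasurableSpace Ω] (P : Measure Ω)
    (X Y : Ω → Set Plane) : Prop :=
  Indep (countSigmaAlgebra.comap X) (countSigmaAlgebra.comap Y) P

/-- Palm mean: `F ω x` is a quantity that the realization `ω` attaches to the point `x` of the
stationary point process `X` of density `lam`. Its mean at the *typical* point of `X` is `v` if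
`v = (lam * |B|)⁻¹ * E[∑ x ∈ X ∩ B, F x]` for each Borel window `B` with `0 < |B| < ∞`. -/
def HasPalmMean {Ω : Type*} [MeasurableSpace Ω] (P : Measure Ω) (lam : ℝ≥0)
    (X : Ω → Set Plane) (F : Ω → Plane → ℝ≥0∞) (v : ℝ≥0∞) : Prop :=
  ∀ B : Set Plane, MeasurableSet B → volume B ≠ 0 → volume B ≠ ∞ →
    AEMeasurable (fun ω => ∑' x : ↥(X ω ∩ B), F ω x) P ∧
    (∫⁻ ω, ∑' x : ↥(X ω ∩ B), F ω x ∂P) / (lam * volume B) = v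

/-! ### Voronoi cells -/

/-- The Voronoi cell of the point `x` with respect to the set of points `S`: the points of the
plane that are closer to `x` than to any other point of `S`. -/
def voronoiCell (S : Set Plane) (x : Plane) : Set Plane :=
  {y | ∀ z ∈ S, z ≠ x → dist y x < dist y z}

/-- The area of the typical Voronoi cell, i.e. of the cell of a point placed at the origin and
added to the configuration `S`. -/
noncomputable def typicalCellArea (S : Set Plane) : ℝ≥0∞ :=
  volume (voronoiCell (insert 0 S) 0)

/-! ### The intrinsically secure communications graph -/

/-- Conditions on the power gain `g r` at link length `r > 0`, without random propagation effects:
continuous, strictly decreasing and vanishing at infinity. Unbounded models such as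
`g r = 1 / r ^ (2 * b)` are singular at `r = 0`, so nothing is asked there. -/
structure IsPathLossGain (g : ℝ → ℝ) : Prop where
  continuousOn : ContinuousOn g (Ioi 0)
  strictAntiOn : StrictAntiOn g (Ioi 0)
  tendsto_zero : Tendsto g atTop (𝓝 0)

/-- Received power with transmit power `p` and path loss only. -/
noncomputable def pathLossPower (p : ℝ) (g : ℝ → ℝ) (x y : Plane) : ℝ := p * g (dist x y)

/-- Maximum secrecy rate of the Gaussian wiretap channel from `x` to `y` with eavesdropper `e`, for
the received powers `Prx`, the noise power `σl2` at legitimate nodes and `σe2` at eavesdroppers. -/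
noncomputable def maxSecrecyRate (Prx : Plane → Plane → ℝ) (σl2 σe2 : ℝ) (x y e : Plane) : ℝ :=
  max (Real.logb 2 (1 + Prx x y / σl2) - Real.logb 2 (1 + Prx x e / σe2)) 0

/-- The directed graph of secure links with legitimate nodes `L`, eavesdroppers `E` and secrecy
rate threshold `ϱ`: there is an edge from `x` to `y ≠ x` if the maximum secrecy rate from `x`
to `y`, against the eavesdropper `e` that receives the most power from `x`, exceeds `ϱ`.
(The graph is carried by the whole plane; only points of `L` are incident to edges.) -/
def iSGraph (Prx : Plane → Plane → ℝ) (σl2 σe2 ϱ : ℝ) (L E : Set Plane) : Digraph Plane where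
  Adj x y := x ∈ L ∧ y ∈ L ∧ x ≠ y ∧
    ∃ e ∈ E, IsMaxOn (Prx x) E e ∧ ϱ < maxSecrecyRate Prx σl2 σe2 x y e

/-- The in-degree of a vertex: the number of edges entering it. -/
noncomputable def inDegree (G : Digraph Plane) (y : Plane) : ℕ∞ := {x | G.Adj x y}.encard

/-- A vertex is in-isolated if it cannot receive from anyone. -/
def InIsolated (G : Digraph Plane) (y : Plane) : Prop := ∀ x, ¬ G.Adj x y

/-! With equal noise powers and strictly decreasing `g`, a rate comparison is a distance comparison:
`x` reaches `y` securely exactly when `y` is nearer to `x` than every eavesdropper is. Seen from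
`y`, the transmitter `x` lies in the Voronoi cell that `y` would have among the eavesdroppers
(`iSGraph_pathLoss_adj_iff`, `setOf_adj_eq`). The in-degree of `y` is therefore the number of other
legitimate nodes in that cell, and in-isolation means that there are none.

For a fixed centre the cell depends on the eavesdroppers only, so it is independent of the
legitimate nodes. The mean count is `lamL` times the mean area, and the conditional probability of
an empty cell is `exp (-lamL * area)`. The mean area is `1 / lamE`: by Tonelli it is the integral of
the probabilities that discs are void, which is a Gaussian integral (`lintegral_volume_nearerSet`).
A similarity of ratio `lamE ^ (-1/2)` reduces the law of the area to unit density
(`lintegral_comp_volume_nearerSet`, `measure_inter_nearerSet_eq_empty`).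

Mecke's formula (`satisfiesMecke`) passes from a fixed centre to the typical node: a sum over nodes
of a function of the node and of the remaining configuration has as its mean `lamL` times an
integral over the plane with the full process in place of the remaining one. It is proved first on
void events, whose probabilities also determine the law of the process. -/

/-! ### Configurations and their σ-algebra. -/

/-- The number of points of a random set is measurable as soon as it is measurable which sets of a
countable basis are hit. -/
theorem measurable_encard_of_hits {α X : Type*} [MeasurableSpace α] [TopologicalSpace X] [T2Space X]
    {b : Set (Set X)} (hbc : b.Countable) (hb : TopologicalSpace.IsTopologicalBasis b)
    {T : α → Set X} (h : ∀ u ∈ b, MeasurableSet {a | (T a ∩ u).Nonempty}) :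
    Measurable fun a => (T a).encard := by
  have key : ∀ n : ℕ, MeasurableSet {a | (n : ℕ∞) ≤ (T a).encard} := by
    intro n
    -- There are at least `n` points iff some `n` pairwise disjoint basic sets are all hit; the
    -- Hausdorff property separates `n` given points. The union is countable because the basis is.
    have : {a | (n : ℕ∞) ≤ (T a).encard} =
        ⋃ v : {v : Fin n → b // Pairwise fun i j => Disjoint (v i : Set X) (v j)},
          ⋂ i, {a | (T a ∩ (v.1 i : Set X)).Nonempty} := by
      ext a
      simp only [mem_ofPred_eq, mem_iUnion, mem_iInter]
      constructor
      · intro hn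
        obtain ⟨t, htT, ht⟩ := exists_subset_encard_eq hn
        have hfin : t.Finite := finite_of_encard_eq_coe ht
        have hcard : hfin.toFinset.card = n := by
          rw [hfin.encard_eq_coe_toFinset_card] at ht; exact_mod_cast ht
        let e := Finset.equivFinOfCardEq hcard
        obtain ⟨U, hU, hd⟩ := hfin.t2_separation
        have hex : ∀ i : Fin n, ∃ u : b, ((e.symm i : X) ∈ (u : Set X)) ∧
            (u : Set X) ⊆ U (e.symm i) := by
          intro i
          obtain ⟨u, hub, h1, h2⟩ := hb.exists_subset_of_mem_open (hU (e.symm i)).1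
            (hU (e.symm i)).2
          exact ⟨⟨u, hub⟩, h1, h2⟩
        choose v hv1 hv2 using hex
        refine ⟨⟨v, fun i j hij => ?_⟩, fun i => ⟨e.symm i, htT ?_, hv1 i⟩⟩
        · refine (hd ?_ ?_ ?_).mono (hv2 i) (hv2 j)
          · exact hfin.mem_toFinset.1 (e.symm i).2
          · exact hfin.mem_toFinset.1 (e.symm j).2
          · exact fun hc => hij (e.symm.injective (Subtype.ext hc))
        · exact hfin.mem_toFinset.1 (e.symm i).2
      · rintro ⟨⟨v, hv⟩, hi⟩
        choose f hf using hi
        have hinj : Function.Injective f := by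
          intro i j hij
          by_contra hne
          exact Set.disjoint_left.1 (hv hne) (hf i).2 (hij ▸ (hf j).2)
        calc (n : ℕ∞) = (range f).encard := by
              rw [← image_univ, hinj.encard_image]; simp
          _ ≤ _ := encard_le_encard (by rintro _ ⟨i, rfl⟩; exact (hf i).1)
    rw [this]
    have := hbc.to_subtype
    exact MeasurableSet.iUnion fun v => MeasurableSet.iInter fun i => h _ (v.1 i).2
  refine ENat.measurable_iff.2 fun n => ?_
  have : (fun a => (T a).encard) ⁻¹' {(n : ℕ∞)} =
      {a | (n : ℕ∞) ≤ (T a).encard} \ {a | ((n + 1 : ℕ) : ℕ∞) ≤ (T a).encard} := by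
    ext a
    simp only [mem_preimage, mem_singleton_iff, Set.mem_sdiff, mem_ofPred_eq, not_le, Nat.cast_add,
      Nat.cast_one]
    rw [ENat.lt_add_one_iff (by simp), and_comm]
    exact le_antisymm_iff
  rw [this]
  exact (key _).diff (key _)

/-- Point configurations in the plane, with the σ-algebra generated by the counts. -/
def Config : Type := Set Plane

/-- The set of points of a configuration. -/
def Config.pts (S : Config) : Set Plane := S

noncomputable instance : MeasurableSpace Config :=
  ⨆ B : {B : Set Plane // MeasurableSet B},
    MeasurableSpace.comap (fun S : Config => (S.pts ∩ B.1).encard) inferInstance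

theorem Config.measurable_count {B : Set Plane} (hB : MeasurableSet B) :
    Measurable fun S : Config => (S.pts ∩ B).encard :=
  Measurable.of_comap_le (le_iSup (fun B : {B : Set Plane // MeasurableSet B} =>
    MeasurableSpace.comap (fun S : Config => (S.pts ∩ B.1).encard) inferInstance) ⟨B, hB⟩)

theorem Config.measurable_iff {α : Type*} [MeasurableSpace α] {X : α → Config} :
    Measurable X ↔ ∀ B, MeasurableSet B → Measurable fun a => ((X a).pts ∩ B).encard := by
  refine ⟨fun h B hB => (measurable_count hB).comp h, fun h => ?_⟩
  rw [measurable_iff_comap_le, instMeasurableSpaceConfig, MeasurableSpace.comap_iSup]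
  refine iSup_le fun B => ?_
  rw [MeasurableSpace.comap_comp]
  exact measurable_iff_comap_le.1 (h B.1 B.2)

theorem Config.measurableSet_hits {B : Set Plane} (hB : MeasurableSet B) :
    MeasurableSet {S : Config | (S.pts ∩ B).Nonempty} := by
  have : {S : Config | (S.pts ∩ B).Nonempty} = {S : Config | (S.pts ∩ B).encard = 0}ᶜ := by
    ext S; simp [nonempty_iff_ne_empty]
  rw [this]
  exact (measurable_count hB (measurableSet_singleton 0)).compl

theorem Config.measurableSet_void {B : Set Plane} (hB : MeasurableSet B) :
    MeasurableSet {S : Config | S.pts ∩ B = ∅} := by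
  have : {S : Config | S.pts ∩ B = ∅} = {S : Config | (S.pts ∩ B).Nonempty}ᶜ := by
    ext S; simp [not_nonempty_iff_eq_empty]
  rw [this]
  exact (measurableSet_hits hB).compl

/-- The events that a Borel set of finite area contains no point. -/
def voidEvents : Set (Set Config) :=
  {s | ∃ D, MeasurableSet D ∧ volume D ≠ ∞ ∧ s = {S : Config | S.pts ∩ D = ∅}}

theorem isPiSystem_voidEvents : IsPiSystem voidEvents := by
  rintro _ ⟨D, hD, hD', rfl⟩ _ ⟨D', hDD, hDD', rfl⟩ -
  refine ⟨D ∪ D', hD.union hDD, measure_union_ne_top hD' hDD', ?_⟩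
  ext S
  simp [inter_union_distrib_left]

theorem univ_mem_voidEvents : univ ∈ voidEvents :=
  ⟨∅, MeasurableSet.empty, by simp, by simp⟩

/-- Counts are recovered from hits of basic open sets, and hits are complements of void events.
Together with `isPiSystem_voidEvents` this makes void probabilities determine the law (Rényi). -/
theorem generateFrom_voidEvents :
    MeasurableSpace.generateFrom voidEvents = instMeasurableSpaceConfig := by
  refine le_antisymm (MeasurableSpace.generateFrom_le ?_) (iSup_le fun B => ?_)
  · rintro _ ⟨D, hD, -, rfl⟩
    exact Config.measurableSet_void hD
  · rw [← measurable_iff_comap_le]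
    have hvoid : ∀ D, MeasurableSet D →
        MeasurableSet[MeasurableSpace.generateFrom voidEvents]
          {S : Config | (S.pts ∩ D).Nonempty} := by
      intro D hD
      -- Void events require finite area, so `D` is exhausted by its intersections with balls.
      have : {S : Config | (S.pts ∩ D).Nonempty} =
          (⋂ n : ℕ, {S : Config | S.pts ∩ (D ∩ Metric.ball 0 n) = ∅})ᶜ := by
        ext S
        simp only [mem_ofPred_eq, mem_compl_iff, mem_iInter, not_forall,
          ← nonempty_iff_ne_empty]
        constructor
        · rintro ⟨x, hx, hxD⟩
          obtain ⟨n, hn⟩ := exists_nat_gt ‖x‖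
          exact ⟨n, x, hx, hxD, by simpa using hn⟩
        · rintro ⟨n, x, hx, hxD, -⟩
          exact ⟨x, hx, hxD⟩
      rw [this]
      refine MeasurableSet.compl (MeasurableSet.iInter fun n => ?_)
      exact MeasurableSpace.measurableSet_generateFrom ⟨_, hD.inter measurableSet_ball,
        ((measure_mono inter_subset_right).trans_lt measure_ball_lt_top).ne, rfl⟩
    refine @measurable_encard_of_hits Config Plane (MeasurableSpace.generateFrom voidEvents) _ _ _
      (TopologicalSpace.countable_countableBasis Plane)
      (TopologicalSpace.isBasis_countableBasis Plane) (fun S => S.pts ∩ B.1) fun u hu => ?_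
    simp_rw [inter_assoc]
    exact hvoid _ (B.2.inter
      (TopologicalSpace.isOpen_of_mem_countableBasis hu).measurableSet)

/-! ### The set of points nearer to `x` than to all points of a configuration -/

/-- The points that are strictly nearer to `x` than to `E`. -/
def nearerSet (E : Set Plane) (x : Plane) : Set Plane := {y | edist y x < Metric.infEDist y E}

/-- Defining the cell through `infEDist` makes it open for every `E`, closed or not, so no
exceptional configuration has to be removed in measurability arguments. -/
theorem isOpen_nearerSet (E : Set Plane) (x : Plane) : IsOpen (nearerSet E x) :=
  isOpen_lt (by fun_prop) Metric.continuous_infEDist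

theorem infEDist_lt_iff_hits {E : Set Plane} {x : Plane} {r : ℝ≥0∞} :
    Metric.infEDist x E < r ↔ (E ∩ Metric.eball x r).Nonempty := by
  simp only [Metric.infEDist_lt_iff, Set.Nonempty, mem_inter_iff, Metric.mem_eball']

/-- The distance is continuous in the point and measurable in the configuration, hence jointly
measurable. -/
theorem measurable_infEDist_config :
    Measurable fun q : Config × Plane => Metric.infEDist q.2 q.1.pts := by
  have h := measurable_uncurry_of_continuous_of_measurable
    (u := fun (x : Plane) (S : Config) => Metric.infEDist x S.pts)
    (fun S => Metric.continuous_infEDist) (fun x => measurable_of_Iio fun r => by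
      simp only [preimage, mem_Iio, infEDist_lt_iff_hits]
      exact Config.measurableSet_hits Metric.isOpen_eball.measurableSet)
  exact h.comp measurable_swap

theorem measurableSet_mem_nearerSet :
    MeasurableSet {q : (Config × Plane) × Plane | q.2 ∈ nearerSet q.1.1.pts q.1.2} :=
  measurableSet_lt (by fun_prop)
    (measurable_infEDist_config.comp (f := fun q : (Config × Plane) × Plane => (q.1.1, q.2))
      (by fun_prop))

theorem measurable_volume_nearerSet (x : Plane) :
    Measurable fun S : Config => volume (nearerSet S.pts x) :=
  (measurable_measure_prodMk_left measurableSet_mem_nearerSet).comp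
    (f := fun S : Config => (S, x)) (by fun_prop)

/-- This decouples `S` from `E`. Moving from `y` to a point `q` at distance less than `r` changes
each of the two distances by at most `r`, so a margin of `2 * r` at `q` suffices. With `q` in a
countable dense set and `r` rational, the joint event becomes a countable union of intersections of
separate conditions. -/
theorem hits_nearerSet_iff {S E u : Set Plane} {x : Plane} {d : Set Plane} (hd : Dense d) :
    (S ∩ nearerSet E x ∩ u).Nonempty ↔ ∃ q ∈ d, ∃ r : ℚ,
      (S ∩ (u ∩ Metric.eball q (ENNReal.ofReal r))).Nonempty ∧
      edist q x + 2 * ENNReal.ofReal r < Metric.infEDist q E := by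
  constructor
  · rintro ⟨y, ⟨hyS, hy⟩, hyu⟩
    have hc : Continuous fun z : Plane × ℝ => edist z.1 x + 2 * ENNReal.ofReal z.2 :=
      (by fun_prop : Continuous fun z : Plane × ℝ => edist z.1 x).add
        ((ENNReal.continuous_const_mul (by simp)).comp (ENNReal.continuous_ofReal.comp continuous_snd))
    have ho : IsOpen {z : Plane × ℝ |
        edist z.1 x + 2 * ENNReal.ofReal z.2 < Metric.infEDist z.1 E} :=
      isOpen_lt hc (Metric.continuous_infEDist.comp continuous_fst)
    -- At margin `0` the inequality is the membership of `y` in the cell; openness lets both the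
    -- point and the margin be perturbed.
    obtain ⟨ε, hε, hball⟩ := Metric.isOpen_iff.1 ho (y, 0) (by simpa [nearerSet] using hy)
    obtain ⟨r, hr0, hrε⟩ := exists_rat_btwn hε
    obtain ⟨q, hq, hqd⟩ := hd.exists_mem_open Metric.isOpen_ball
      ((Metric.nonempty_ball (x := y)).2 hr0)
    rw [Metric.mem_ball] at hqd
    have hmem : (q, (r : ℝ)) ∈ Metric.ball (y, (0 : ℝ)) ε := by
      rw [Metric.mem_ball, Prod.dist_eq, max_lt_iff]
      refine ⟨hqd.trans hrε, ?_⟩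
      rw [Real.dist_eq, sub_zero, abs_of_pos hr0]
      exact hrε
    have hlt := hball hmem
    rw [mem_ofPred_eq] at hlt
    refine ⟨q, hq, r, ⟨y, hyS, hyu, ?_⟩, hlt⟩
    rw [Metric.mem_eball, edist_dist, dist_comm]
    exact (ENNReal.ofReal_lt_ofReal_iff hr0).2 hqd
  · rintro ⟨q, -, r, ⟨y, hyS, hyu, hyq⟩, h⟩
    rw [Metric.mem_eball] at hyq
    refine ⟨y, ⟨hyS, ?_⟩, hyu⟩
    have h1 : Metric.infEDist q E ≤ Metric.infEDist y E + edist y q := by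
      rw [edist_comm]; exact Metric.infEDist_le_infEDist_add_edist
    have h2 : edist y x ≤ edist q x + ENNReal.ofReal r := by
      calc _ ≤ edist y q + edist q x := edist_triangle _ _ _
        _ ≤ _ := by rw [add_comm]; gcongr
    show edist y x < _
    by_contra! hcon
    refine absurd h (not_lt.2 ?_)
    calc _ ≤ edist y x + edist y q := h1.trans (by gcongr)
      _ ≤ edist q x + ENNReal.ofReal r + ENNReal.ofReal r := by gcongr
      _ = _ := by ring

theorem measurable_encard_inter_nearerSet :
    Measurable fun q : (Config × Config) × Plane => (q.1.1.pts ∩ nearerSet q.1.2.pts q.2).encard := by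
  refine measurable_encard_of_hits (TopologicalSpace.countable_countableBasis Plane)
    (TopologicalSpace.isBasis_countableBasis Plane) fun u hu => ?_
  have hu := TopologicalSpace.isOpen_of_mem_countableBasis hu
  obtain ⟨d, hdc, hd⟩ := TopologicalSpace.exists_countable_dense Plane
  simp_rw [hits_nearerSet_iff hd]
  have : {q : (Config × Config) × Plane | ∃ z ∈ d, ∃ r : ℚ,
      (q.1.1.pts ∩ (u ∩ Metric.eball z (ENNReal.ofReal r))).Nonempty ∧
      edist z q.2 + 2 * ENNReal.ofReal r < Metric.infEDist z q.1.2.pts} =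
      ⋃ z ∈ d, ⋃ r : ℚ, {q : (Config × Config) × Plane |
        (q.1.1.pts ∩ (u ∩ Metric.eball z (ENNReal.ofReal r))).Nonempty} ∩
        {q : (Config × Config) × Plane |
          edist z q.2 + 2 * ENNReal.ofReal r < Metric.infEDist z q.1.2.pts} := by
    ext q; simp
  rw [this]
  refine MeasurableSet.biUnion hdc fun z _ => MeasurableSet.iUnion fun r => MeasurableSet.inter ?_ ?_
  · exact (Config.measurableSet_hits (hu.inter Metric.isOpen_eball).measurableSet).preimage
      (f := fun q : (Config × Config) × Plane => q.1.1) (by fun_prop)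
  · exact measurableSet_lt (by fun_prop) (measurable_infEDist_config.comp
      (f := fun q : (Config × Config) × Plane => (q.1.2, z)) (by fun_prop))

/-! ### The mean of a Poisson law. -/

theorem lintegral_natCast_poissonMeasure (r : ℝ≥0) :
    ∫⁻ n : ℕ, (n : ℝ≥0∞) ∂(poissonMeasure r) = r := by
  rw [lintegral_countable']
  simp only [poissonMeasure_singleton]
  rw [tsum_eq_zero_add' ENNReal.summable]
  -- Weighting the mass at `n + 1` by `n + 1` gives `r` times the mass at `n`, so the mean is `r`
  -- times the total mass.
  have h : ∀ n : ℕ, ((n + 1 : ℕ) : ℝ≥0∞) *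
      ENNReal.ofReal (Real.exp (-r) * r ^ (n + 1) / (n + 1).factorial) =
      r * (poissonMeasure r) {n} := by
    intro n
    rw [poissonMeasure_singleton, ← ENNReal.ofReal_natCast, ← ENNReal.ofReal_coe_nnreal,
      ← ENNReal.ofReal_mul (by positivity), ← ENNReal.ofReal_mul (by positivity),
      Nat.factorial_succ]
    congr 1
    push_cast
    field_simp
    ring
  simp_rw [h]
  have h1 : ∑' n : ℕ, (poissonMeasure r) {n} = 1 := by
    rw [← measure_univ (μ := poissonMeasure r), ← lintegral_one, lintegral_countable']
    simp
  rw [ENNReal.tsum_mul_left, h1]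
  simp

/-! ### Locally finite sets -/

theorem isClosed_of_finite_inter_closedBall {E : Set Plane}
    (h : ∀ r : ℝ, (E ∩ Metric.closedBall 0 r).Finite) : IsClosed E := by
  refine isClosed_of_closure_subset fun x hx => ?_
  have h1 : x ∈ closure (Metric.ball 0 (‖x‖ + 1) ∩ E) :=
    Metric.isOpen_ball.inter_closure ⟨by simp, hx⟩
  have h2 : closure (Metric.ball 0 (‖x‖ + 1) ∩ E) ⊆ E ∩ Metric.closedBall 0 (‖x‖ + 1) :=
    closure_minimal (fun y hy => ⟨hy.2, Metric.ball_subset_closedBall hy.1⟩) (h _).isClosed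
  exact (h2 h1).1

/-- Closedness makes the infimum attained, so strict inequality at each point survives in the
infimum. For empty `E` the infimum is `⊤` and both sides hold. -/
theorem IsClosed.mem_nearerSet_iff {E : Set Plane} (hE : IsClosed E) {x y : Plane} :
    y ∈ nearerSet E x ↔ ∀ e ∈ E, dist y x < dist y e := by
  refine ⟨fun h e he => ?_, fun h => ?_⟩
  · have := lt_of_lt_of_le h (Metric.infEDist_le_edist_of_mem he)
    rwa [edist_dist, edist_dist, ENNReal.ofReal_lt_ofReal_iff_of_nonneg dist_nonneg] at this
  · rcases E.eq_empty_or_nonempty with rfl | hne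
    · simp [nearerSet, edist_lt_top]
    · obtain ⟨e, he, hd⟩ := hE.exists_infDist_eq_dist hne y
      show edist y x < Metric.infEDist y E
      rw [← ENNReal.ofReal_toReal (Metric.infEDist_ne_top hne)]
      change _ < ENNReal.ofReal (Metric.infDist y E)
      rw [hd, edist_dist, ENNReal.ofReal_lt_ofReal_iff_of_nonneg dist_nonneg]
      exact h e he

/-! ### First consequences of the Poisson axioms, and the mean area of a cell. -/

namespace IsPoissonProcess

variable {Ω : Type*} [MeasurableSpace Ω] {P : Measure Ω} {lam : ℝ≥0} {X : Ω → Config}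
  {B C D : Set Plane}

theorem measurable (hX : IsPoissonProcess P lam fun ω => (X ω).pts) : Measurable X :=
  Config.measurable_iff.2 hX.measurable_count

theorem measurable_encard_toENNReal (hX : IsPoissonProcess P lam fun ω => (X ω).pts)
    (hB : MeasurableSet B) : Measurable fun ω => (((X ω).pts ∩ B).encard : ℝ≥0∞) :=
  (Measurable.of_discrete (f := fun n : ℕ∞ => (n : ℝ≥0∞))).comp (hX.measurable_count B hB)

theorem lintegral_encard (hX : IsPoissonProcess P lam fun ω => (X ω).pts) (hB : MeasurableSet B)
    (hv : volume B ≠ ∞) :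
    ∫⁻ ω, (((X ω).pts ∩ B).encard : ℝ≥0∞) ∂P = lam * volume B := by
  have h := (hX.hasLaw_count B hB hv).lintegral_comp (f := fun n : ℕ∞ => (n : ℝ≥0∞))
    (Measurable.of_discrete.aemeasurable)
  rw [h, lintegral_map .of_discrete .of_discrete]
  simp only [ENat.toENNReal_coe]
  rw [lintegral_natCast_poissonMeasure, ENNReal.coe_mul, ENNReal.coe_toNNReal hv]

theorem measure_encard_eq (hX : IsPoissonProcess P lam fun ω => (X ω).pts) (hB : MeasurableSet B)
    (hv : volume B ≠ ∞) (n : ℕ) :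
    P {ω | ((X ω).pts ∩ B).encard = n} =
      ENNReal.ofReal (Real.exp (-(lam * volume.real B)) * (lam * volume.real B) ^ n /
        n.factorial) := by
  have h := (hX.hasLaw_count B hB hv)
  have : P {ω | ((X ω).pts ∩ B).encard = n} =
      (P.map fun ω => ((X ω).pts ∩ B).encard) {(n : ℕ∞)} :=
    (Measure.map_apply (hX.measurable_count B hB) (measurableSet_singleton _)).symm
  rw [this, h.map_eq, Measure.map_apply .of_discrete (measurableSet_singleton _)]
  have h2 : (fun n : ℕ => (n : ℕ∞)) ⁻¹' {(n : ℕ∞)} = {n} := by ext; simp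
  rw [h2, poissonMeasure_singleton]
  rfl

theorem measure_void (hX : IsPoissonProcess P lam fun ω => (X ω).pts) (hB : MeasurableSet B)
    (hv : volume B ≠ ∞) :
    P {ω | (X ω).pts ∩ B = ∅} = ENNReal.ofReal (Real.exp (-(lam * volume.real B))) := by
  simpa using hX.measure_encard_eq hB hv 0

theorem ae_nonempty (hX : IsPoissonProcess P lam fun ω => (X ω).pts)
    (hlam : 0 < lam) : ∀ᵐ ω ∂P, (X ω).pts.Nonempty := by
  have hle : ∀ n : ℕ, P {ω | ¬ (X ω).pts.Nonempty} ≤ ENNReal.ofReal (Real.exp (-(lam * n))) := by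
    intro n
    calc P {ω | ¬ (X ω).pts.Nonempty}
        ≤ P {ω | (X ω).pts ∩ Metric.ball 0 n = ∅} := measure_mono fun ω hω => by
          have : (X ω).pts = ∅ := not_nonempty_iff_eq_empty.1 hω
          simp [this]
      _ = _ := hX.measure_void measurableSet_ball measure_ball_lt_top.ne
      _ ≤ _ := by
        gcongr
        rw [measureReal_def, EuclideanSpace.volume_ball_fin_two, ENNReal.toReal_mul,
          ← ENNReal.ofReal_pow (by positivity), ENNReal.toReal_ofReal (by positivity)]
        rw [ENNReal.toReal_ofReal Real.pi_nonneg]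
        -- The area `π * n ^ 2` of the ball is at least `n`, which suffices for the bound to tend to
        -- zero.
        rcases n.eq_zero_or_pos with rfl | hn
        · simp
        · have h1 : (1 : ℝ) ≤ n := by exact_mod_cast hn
          nlinarith [Real.pi_gt_three]
  have hlim : Tendsto (fun n : ℕ => ENNReal.ofReal (Real.exp (-(lam * n)))) atTop (𝓝 0) := by
    rw [← ENNReal.ofReal_zero]
    refine ENNReal.tendsto_ofReal (Real.tendsto_exp_neg_atTop_nhds_zero.comp ?_)
    exact (tendsto_natCast_atTop_atTop).const_mul_atTop (by exact_mod_cast hlam)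
  exact le_antisymm (ge_of_tendsto' hlim hle) zero_le

theorem ae_notMem (hX : IsPoissonProcess P lam fun ω => (X ω).pts) (x : Plane) :
    ∀ᵐ ω ∂P, x ∉ (X ω).pts := by
  have h := hX.lintegral_encard (measurableSet_singleton x) (by simp)
  rw [measure_singleton, mul_zero, lintegral_eq_zero_iff
    (hX.measurable_encard_toENNReal (measurableSet_singleton x))] at h
  filter_upwards [h] with ω hω hx
  have h0 : (X ω).pts ∩ {x} = ∅ := by simpa using hω
  exact (h0 ▸ ⟨hx, rfl⟩ : x ∈ (∅ : Set Plane))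

theorem ae_finite (hX : IsPoissonProcess P lam fun ω => (X ω).pts) :
    ∀ᵐ ω ∂P, ∀ r : ℝ, ((X ω).pts ∩ Metric.closedBall 0 r).Finite := by
  have h : ∀ᵐ ω ∂P, ∀ n : ℕ, ((X ω).pts ∩ Metric.closedBall 0 n).encard < ⊤ := by
    refine ae_all_iff.2 fun n => ?_
    have := ae_lt_top (μ := P)
      (hX.measurable_encard_toENNReal (measurableSet_closedBall (x := 0) (ε := (n : ℝ))))
      (by
        have := hX.lintegral_encard (measurableSet_closedBall (x := (0 : Plane)) (ε := (n : ℝ)))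
          measure_closedBall_lt_top.ne
        rw [this]
        exact ENNReal.mul_ne_top (by simp) measure_closedBall_lt_top.ne)
    filter_upwards [this] with ω hω
    simpa using hω
  filter_upwards [h] with ω hω r
  obtain ⟨n, hn⟩ := exists_nat_ge r
  exact (encard_lt_top_iff.1 (hω n)).subset (by gcongr)

theorem indepFun_encard (hX : IsPoissonProcess P lam fun ω => (X ω).pts) (hB : MeasurableSet B)
    (hC : MeasurableSet C) (hd : Disjoint B C) :
    IndepFun (fun ω => ((X ω).pts ∩ B).encard) (fun ω => ((X ω).pts ∩ C).encard) P := by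
  have := hX.indep_count 2 ![B, C] (by simp [Fin.forall_fin_two, hB, hC]) (by
    intro i j hij
    fin_cases i <;> fin_cases j <;> simp_all [disjoint_comm])
  exact this.indepFun (i := 0) (j := 1) (by simp)

theorem ae_isClosed (hX : IsPoissonProcess P lam fun ω => (X ω).pts) :
    ∀ᵐ ω ∂P, IsClosed (X ω).pts := by
  filter_upwards [hX.ae_finite] with ω hω using isClosed_of_finite_inter_closedBall hω

theorem ae_infEDist_pos (hX : IsPoissonProcess P lam fun ω => (X ω).pts)
    (hlam : 0 < lam) (x : Plane) : ∀ᵐ ω ∂P, 0 < Metric.infEDist x (X ω).pts := by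
  filter_upwards [hX.ae_isClosed, hX.ae_notMem x, hX.ae_nonempty hlam] with ω hcl hx hne
  rw [pos_iff_ne_zero]
  exact fun h => hx ((Metric.mem_iff_infEDist_zero_of_closed hcl).2 h)

/-- Almost surely `y` is in the cell of `x` iff the closed disc about `y` with `x` on its boundary
is void; its area is `π * ‖y - x‖ ^ 2`. -/
theorem measure_mem_nearerSet (hX : IsPoissonProcess P lam fun ω => (X ω).pts) (x y : Plane) :
    P {ω | y ∈ nearerSet (X ω).pts x} =
      ENNReal.ofReal (Real.exp (-(lam * Real.pi) * ‖y - x‖ ^ 2)) := by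
  have h : P {ω | y ∈ nearerSet (X ω).pts x} =
      P {ω | (X ω).pts ∩ Metric.closedBall y (dist y x) = ∅} := by
    refine measure_congr ?_
    filter_upwards [hX.ae_isClosed] with ω hω
    refine propext ?_
    change y ∈ nearerSet (X ω).pts x ↔ (X ω).pts ∩ Metric.closedBall y (dist y x) = ∅
    rw [hω.mem_nearerSet_iff, eq_empty_iff_forall_notMem]
    simp only [mem_inter_iff, Metric.mem_closedBall', not_and, not_le]
  rw [h, hX.measure_void measurableSet_closedBall measure_closedBall_lt_top.ne, measureReal_def,
    EuclideanSpace.volume_closedBall_fin_two, ENNReal.toReal_mul,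
    ← ENNReal.ofReal_pow (by positivity), ENNReal.toReal_ofReal (by positivity), dist_eq_norm]
  rw [ENNReal.toReal_ofReal Real.pi_nonneg]
  congr 2
  ring

/-- By Tonelli the mean area is the integral of the membership probabilities, a planar Gaussian
integral with value `π / (lam * π)`. -/
theorem lintegral_volume_nearerSet [SFinite P] (hX : IsPoissonProcess P lam fun ω => (X ω).pts)
    (hlam : 0 < lam) (x : Plane) :
    ∫⁻ ω, volume (nearerSet (X ω).pts x) ∂P = (lam : ℝ≥0∞)⁻¹ := by
  have hms : MeasurableSet {q : Ω × Plane | q.2 ∈ nearerSet (X q.1).pts x} :=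
    measurableSet_mem_nearerSet.preimage (f := fun q : Ω × Plane => ((X q.1, x), q.2))
      (((hX.measurable.comp measurable_fst).prodMk measurable_const).prodMk measurable_snd)
  have h1 : ∫⁻ ω, volume (nearerSet (X ω).pts x) ∂P =
      ∫⁻ y : Plane, P {ω | y ∈ nearerSet (X ω).pts x} :=
    (Measure.prod_apply hms).symm.trans (Measure.prod_apply_symm hms)
  rw [h1]
  simp_rw [hX.measure_mem_nearerSet]
  have hb : 0 < (lam : ℝ) * Real.pi := mul_pos (by exact_mod_cast hlam) Real.pi_pos
  rw [lintegral_sub_right_eq_self (fun y : Plane =>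
    ENNReal.ofReal (Real.exp (-(lam * Real.pi) * ‖y‖ ^ 2))) x]
  have hG := GaussianFourier.integral_rexp_neg_mul_sq_norm (V := Plane) hb
  have hval : (Real.pi / (lam * Real.pi)) ^ ((Module.finrank ℝ Plane : ℝ) / 2) =
      (lam : ℝ)⁻¹ := by
    have : (lam : ℝ) ≠ 0 := by exact_mod_cast hlam.ne'
    simp
    field_simp
  rw [hval] at hG
  rw [← ofReal_integral_eq_lintegral_ofReal, hG, ENNReal.ofReal_inv_of_pos (by exact_mod_cast hlam),
    ENNReal.ofReal_coe_nnreal]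
  · refine Integrable.of_integral_ne_zero ?_
    rw [hG]
    simpa using hlam.ne'
  · exact ae_of_all _ fun y => by positivity

end IsPoissonProcess

/-! ### Mecke's formula -/

/-- The configuration `S` without the point `x`. -/
def Config.erase (S : Config) (x : Plane) : Config := (S.pts \ {x} : Set Plane)

theorem Config.pts_erase (S : Config) (x : Plane) : (S.erase x).pts = S.pts \ {x} := rfl

/-- The sum over the points `x` of `S` of a function of `S \ {x}`, a parameter, and `x`. -/
noncomputable def pointSum {Θ : Type*} (f : (Config × Θ) × Plane → ℝ≥0∞) (S : Config) (θ : Θ) :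
    ℝ≥0∞ :=
  ∑' x : S.pts, f ((S.erase x, θ), x)

theorem pointSum_indicator_one {Θ : Type*} (W : Set ((Config × Θ) × Plane)) (S : Config) (θ : Θ) :
    pointSum (W.indicator 1) S θ = ({x ∈ S.pts | ((S.erase x, θ), x) ∈ W}.encard : ℝ≥0∞) := by
  rw [← ENNReal.tsum_set_one, pointSum,
    tsum_subtype S.pts (fun x => W.indicator (1 : (Config × Θ) × Plane → ℝ≥0∞) ((S.erase x, θ), x)),
    tsum_subtype {x ∈ S.pts | ((S.erase x, θ), x) ∈ W} (fun _ => (1 : ℝ≥0∞))]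
  refine tsum_congr fun x => ?_
  by_cases h1 : x ∈ S.pts <;> by_cases h2 : ((S.erase x, θ), x) ∈ W <;> simp [h1, h2, indicator]

theorem indicator_iUnion_eq_tsum {α : Type*} {s : ℕ → Set α}
    (hs : Pairwise fun i j => Disjoint (s i) (s j)) :
    (⋃ n, s n).indicator (1 : α → ℝ≥0∞) = fun a => ∑' n, (s n).indicator 1 a := by
  ext a
  by_cases h : a ∈ ⋃ n, s n
  · obtain ⟨n, hn⟩ := mem_iUnion.1 h
    rw [indicator_of_mem h, tsum_eq_single n fun m hm =>
      indicator_of_notMem (fun ha => Set.disjoint_left.1 (hs hm) ha hn) _, indicator_of_mem hn]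
  · rw [indicator_of_notMem h]
    rw [mem_iUnion, not_exists] at h
    simp [h]

/-- If `D` is void, erasing changes nothing and the points of `C \ D` are counted. Otherwise the
erased point must be the only point of `S` in `D` and must lie in `C`. Each product on the right
involves two disjoint sets, so independence applies to it. -/
theorem encard_void_erase (S C D : Set Plane) :
    ({x ∈ S | (S \ {x}) ∩ D = ∅ ∧ x ∈ C}.encard : ℝ≥0∞) =
      ((S ∩ (C \ D)).encard : ℝ≥0∞) * {n : ℕ∞ | n = 0}.indicator 1 (S ∩ D).encard +
      {n : ℕ∞ | n = 1}.indicator 1 (S ∩ (C ∩ D)).encard *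
        {n : ℕ∞ | n = 0}.indicator 1 (S ∩ (D \ C)).encard := by
  by_cases h : S ∩ D = ∅
  · have h1 : S ∩ (C ∩ D) = ∅ := subset_empty_iff.1 (h ▸ fun x hx => ⟨hx.1, hx.2.2⟩)
    have h2 : {x ∈ S | (S \ {x}) ∩ D = ∅ ∧ x ∈ C} = S ∩ (C \ D) := by
      ext x
      have : x ∈ S → x ∉ D := fun hx hD => (h ▸ ⟨hx, hD⟩ : x ∈ (∅ : Set Plane))
      have h3 : (S \ {x}) ∩ D = ∅ :=
        subset_empty_iff.1 (h ▸ fun y hy => ⟨hy.1.1, hy.2⟩)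
      simp only [h3, true_and, mem_inter_iff, Set.mem_sdiff, mem_ofPred_eq]
      tauto
    simp [h, h1, h2]
  · by_cases h' : (S ∩ (C ∩ D)).encard = 1 ∧ S ∩ (D \ C) = ∅
    · obtain ⟨a, ha⟩ := encard_eq_one.1 h'.1
      have h2 : {x ∈ S | (S \ {x}) ∩ D = ∅ ∧ x ∈ C} = {a} := by
        ext x
        simp only [Set.ext_iff, mem_inter_iff, Set.mem_sdiff, mem_singleton_iff, mem_empty_iff_false,
          mem_ofPred_eq] at ha h' ⊢
        have haa := (ha a).2 rfl
        constructor
        · rintro ⟨hx, hxd, hxC⟩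
          by_contra hne
          exact (hxd a).1 ⟨⟨haa.1, Ne.symm hne⟩, haa.2.2⟩
        · rintro rfl
          refine ⟨haa.1, fun y => ⟨?_, False.elim⟩, haa.2.1⟩
          rintro ⟨⟨hy, hyx⟩, hyD⟩
          by_cases hyC : y ∈ C
          · exact hyx ((ha y).1 ⟨hy, hyC, hyD⟩)
          · exact (h'.2 y).1 ⟨hy, hyD, hyC⟩
      simp [h, h'.1, h'.2, h2]
    · have h2 : {x ∈ S | (S \ {x}) ∩ D = ∅ ∧ x ∈ C} = ∅ := by
        rw [eq_empty_iff_forall_notMem]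
        rintro x ⟨hx, hxd, hxC⟩
        have hyx : ∀ y ∈ S, y ∈ D → y = x := fun y hy hyD => by
          by_contra hne
          exact (hxd ▸ ⟨⟨hy, hne⟩, hyD⟩ : y ∈ (∅ : Set Plane))
        obtain ⟨z, hzS, hzD⟩ := nonempty_iff_ne_empty.2 h
        have hxD : x ∈ D := hyx z hzS hzD ▸ hzD
        refine h' ⟨encard_eq_one.2 ⟨x, ?_⟩, ?_⟩
        · ext y
          simp only [mem_inter_iff, mem_singleton_iff]
          exact ⟨fun hy => hyx y hy.1 hy.2.2, fun hy => hy ▸ ⟨hx, hxC, hxD⟩⟩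
        · rw [eq_empty_iff_forall_notMem]
          rintro y ⟨hy, hyD, hyC⟩
          exact hyC (hyx y hy hyD ▸ hxC)
      rw [not_and_or] at h'
      rcases h' with h' | h' <;> simp [h, h', h2]

/-- Products of void events, measurable sets of parameters and Borel sets. -/
def voidBoxes (Θ : Type*) [MeasurableSpace Θ] : Set (Set ((Config × Θ) × Plane)) :=
  image2 (· ×ˢ ·) (image2 (· ×ˢ ·) voidEvents {G | MeasurableSet G}) {C | MeasurableSet C}

theorem isPiSystem_voidBoxes (Θ : Type*) [MeasurableSpace Θ] : IsPiSystem (voidBoxes Θ) :=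
  (isPiSystem_voidEvents.prod MeasurableSpace.isPiSystem_measurableSet).prod
    MeasurableSpace.isPiSystem_measurableSet

theorem generateFrom_voidBoxes (Θ : Type*) [MeasurableSpace Θ] :
    MeasurableSpace.generateFrom (voidBoxes Θ) = Prod.instMeasurableSpace := by
  have hs : IsCountablySpanning voidEvents :=
    ⟨fun _ => univ, fun _ => univ_mem_voidEvents, iUnion_const _⟩
  exact generateFrom_eq_prod
    (generateFrom_eq_prod generateFrom_voidEvents MeasurableSpace.generateFrom_measurableSet
      hs isCountablySpanning_measurableSet)
    MeasurableSpace.generateFrom_measurableSet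
    (hs.prod isCountablySpanning_measurableSet) isCountablySpanning_measurableSet

namespace IsPoissonProcess

variable {Ω : Type*} [MeasurableSpace Ω] {P : Measure Ω} {lam : ℝ≥0} {X : Ω → Config}
  {B C D : Set Plane} {Θ : Type*} [MeasurableSpace Θ] {Y : Ω → Θ}

/-- This is Mecke's formula for a void event and a window. The part `C \ D` contributes its mean
count times the void probability of `D`. For `C ∩ D`, the probability of exactly one point is `lam *
|C ∩ D|` times the void probability, and the void probabilities of `C ∩ D` and `D \ C` multiply to
that of `D`. -/
theorem lintegral_void_erase (hX : IsPoissonProcess P lam fun ω => (X ω).pts)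
    (hC : MeasurableSet C) (hCv : volume C ≠ ∞) (hD : MeasurableSet D) (hDv : volume D ≠ ∞) :
    ∫⁻ ω, ({x ∈ (X ω).pts | ((X ω).pts \ {x}) ∩ D = ∅ ∧ x ∈ C}.encard : ℝ≥0∞) ∂P =
      lam * volume C * P {ω | (X ω).pts ∩ D = ∅} := by
  have hCD : volume (C \ D) ≠ ∞ := measure_ne_top_of_subset sdiff_subset hCv
  have hDC : volume (D \ C) ≠ ∞ := measure_ne_top_of_subset sdiff_subset hDv
  have hCiD : volume (C ∩ D) ≠ ∞ := measure_ne_top_of_subset inter_subset_left hCv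
  have hm : ∀ B n, MeasurableSet B →
      MeasurableSet {ω | ((X ω).pts ∩ B).encard = n} := fun B n hB =>
    hX.measurable_count B hB (measurableSet_singleton n)
  have hind : ∀ B : Set Plane, MeasurableSet B → ∀ n : ℕ∞,
      ∫⁻ ω, {m : ℕ∞ | m = n}.indicator (1 : ℕ∞ → ℝ≥0∞) ((X ω).pts ∩ B).encard ∂P =
      P {ω | ((X ω).pts ∩ B).encard = n} := fun B hB n => by
    rw [← lintegral_indicator_one (hm B n hB)]
    rfl
  have hmI : ∀ B : Set Plane, MeasurableSet B → ∀ n : ℕ∞, Measurable fun ω =>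
      {m : ℕ∞ | m = n}.indicator (1 : ℕ∞ → ℝ≥0∞) ((X ω).pts ∩ B).encard := fun B hB n =>
    (Measurable.of_discrete (f := {m : ℕ∞ | m = n}.indicator (1 : ℕ∞ → ℝ≥0∞))).comp
      (hX.measurable_count B hB)
  simp_rw [encard_void_erase]
  have hm1 : Measurable fun ω => (((X ω).pts ∩ (C \ D)).encard : ℝ≥0∞) *
      {m : ℕ∞ | m = 0}.indicator (1 : ℕ∞ → ℝ≥0∞) ((X ω).pts ∩ D).encard :=
    (hX.measurable_encard_toENNReal (hC.diff hD)).mul (hmI D hD 0)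
  rw [lintegral_add_left hm1]
  have h1 := lintegral_mul_eq_lintegral_mul_lintegral_of_indepFun
    (hX.measurable_encard_toENNReal (hC.diff hD)) (hmI D hD 0)
    ((hX.indepFun_encard (hC.diff hD) hD disjoint_sdiff_left).comp
      (φ := fun n : ℕ∞ => (n : ℝ≥0∞)) (ψ := {m : ℕ∞ | m = 0}.indicator (1 : ℕ∞ → ℝ≥0∞))
      .of_discrete .of_discrete)
  have h2 := lintegral_mul_eq_lintegral_mul_lintegral_of_indepFun
    (hmI _ (hC.inter hD) 1) (hmI _ (hD.diff hC) 0)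
    ((hX.indepFun_encard (hC.inter hD) (hD.diff hC)
      (disjoint_sdiff_right.mono_left inter_subset_left)).comp
      (φ := {m : ℕ∞ | m = 1}.indicator (1 : ℕ∞ → ℝ≥0∞))
      (ψ := {m : ℕ∞ | m = 0}.indicator (1 : ℕ∞ → ℝ≥0∞)) .of_discrete .of_discrete)
  simp only [Pi.mul_apply] at h1 h2
  rw [h1, h2, hX.lintegral_encard (hC.diff hD) hCD, hind D hD, hind _ (hC.inter hD),
    hind _ (hD.diff hC)]
  have e1 := hX.measure_encard_eq (hC.inter hD) hCiD 1
  rw [Nat.cast_one] at e1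
  simp only [encard_eq_zero]
  rw [e1, hX.measure_void hD hDv, hX.measure_void (hD.diff hC) hDC]
  have e2 : volume.real D = volume.real (C ∩ D) + volume.real (D \ C) := by
    rw [inter_comm, measureReal_inter_add_sdiff hC hDv]
  have e3 : volume C = volume (C ∩ D) + volume (C \ D) := (measure_inter_add_sdiff C hD).symm
  rw [e3, e2, ← ENNReal.ofReal_mul (by positivity), mul_add (lam : ℝ≥0∞), add_mul, add_comm]
  congr 1
  rw [← ofReal_measureReal hCiD, ← ENNReal.ofReal_coe_nnreal, ← ENNReal.ofReal_mul (by positivity),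
    ← ENNReal.ofReal_mul (by positivity)]
  congr 1
  rw [mul_add, neg_add, Real.exp_add]
  simp
  ring

/-- The property expressed by Mecke's formula. -/
def SatisfiesMecke (P : Measure Ω) (lam : ℝ≥0) (X : Ω → Config) (Y : Ω → Θ)
    (f : (Config × Θ) × Plane → ℝ≥0∞) : Prop :=
  AEMeasurable (fun ω => pointSum f (X ω) (Y ω)) P ∧
    ∫⁻ ω, pointSum f (X ω) (Y ω) ∂P =
      lam * ∫⁻ q, f q ∂((P.map fun ω => (X ω, Y ω)).prod volume)

theorem satisfiesMecke_box [IsProbabilityMeasure P]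
    (hX : IsPoissonProcess P lam fun ω => (X ω).pts)
    (hY : Measurable Y) (hXY : IndepFun X Y P) (hC : MeasurableSet C) (hCv : volume C ≠ ∞)
    {W : Set ((Config × Θ) × Plane)} (hW : W ∈ voidBoxes Θ) :
    SatisfiesMecke P lam X Y ((W ∩ univ ×ˢ C).indicator 1) := by
  obtain ⟨_, ⟨_, ⟨D, hD, hDv, rfl⟩, G, hG, rfl⟩, C', hC', rfl⟩ := hW
  rw [mem_ofPred_eq] at hG hC'
  have hCC : MeasurableSet (C' ∩ C) := hC'.inter hC
  have hCCv : volume (C' ∩ C) ≠ ∞ := measure_ne_top_of_subset inter_subset_right hCv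
  rw [prod_inter_prod, inter_univ]
  set W := ({S : Config | S.pts ∩ D = ∅} ×ˢ G) ×ˢ (C' ∩ C)
  have hform : ∀ ω, pointSum (W.indicator 1) (X ω) (Y ω) =
      ({x ∈ (X ω).pts | ((X ω).pts \ {x}) ∩ D = ∅ ∧ x ∈ C' ∩ C}.encard : ℝ≥0∞) *
        G.indicator 1 (Y ω) := by
    intro ω
    rw [pointSum_indicator_one]
    by_cases hG : Y ω ∈ G <;> simp [W, hG, Config.pts_erase]
  have hm1 : Measurable fun S : Config =>
      ({x ∈ S.pts | (S.pts \ {x}) ∩ D = ∅ ∧ x ∈ C' ∩ C}.encard : ℝ≥0∞) := by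
    simp_rw [encard_void_erase]
    have h : ∀ (φ : ℕ∞ → ℝ≥0∞) {B}, MeasurableSet B →
        Measurable fun S : Config => φ (S.pts ∩ B).encard := fun φ B hB =>
      (Measurable.of_discrete (f := φ)).comp (Config.measurable_count hB)
    exact ((h _ (hCC.diff hD)).mul (h _ hD)).add ((h _ (hCC.inter hD)).mul (h _ (hD.diff hCC)))
  have hm2 : Measurable (G.indicator (1 : Θ → ℝ≥0∞)) := measurable_one.indicator hG
  refine ⟨?_, ?_⟩
  · simp_rw [hform]
    exact ((hm1.comp hX.measurable).mul (hm2.comp hY)).aemeasurable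
  · simp_rw [hform]
    have h1 := lintegral_mul_eq_lintegral_mul_lintegral_of_indepFun
      (hm1.comp hX.measurable) (hm2.comp hY) (hXY.comp hm1 hm2)
    simp only [Pi.mul_apply, Function.comp_apply] at h1
    rw [h1, hX.lintegral_void_erase hCC hCCv hD hDv, lintegral_indicator_one, Measure.prod_prod,
      Measure.map_apply (hX.measurable.prodMk hY) ((Config.measurableSet_void hD).prod hG)]
    · have h2 := hXY.measure_inter_preimage_eq_mul _ _ (Config.measurableSet_void hD) hG
      have h3 : (fun ω => (X ω, Y ω)) ⁻¹' ({S : Config | S.pts ∩ D = ∅} ×ˢ G) =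
          X ⁻¹' {S : Config | S.pts ∩ D = ∅} ∩ Y ⁻¹' G := rfl
      have h4 : ∫⁻ ω, G.indicator (1 : Θ → ℝ≥0∞) (Y ω) ∂P = P (Y ⁻¹' G) :=
        (lintegral_indicator_one (hY hG))
      rw [h3, h2, h4]
      change _ * P (X ⁻¹' {S : Config | S.pts ∩ D = ∅}) * _ = _
      ring
    · exact ((Config.measurableSet_void hD).prod hG).prod hCC

theorem SatisfiesMecke.tsum {f : ℕ → (Config × Θ) × Plane → ℝ≥0∞} (hf : ∀ n, Measurable (f n))
    (h : ∀ n, SatisfiesMecke P lam X Y (f n)) :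
    SatisfiesMecke P lam X Y fun q => ∑' n, f n q := by
  have e : ∀ ω, pointSum (fun q => ∑' n, f n q) (X ω) (Y ω) = ∑' n, pointSum (f n) (X ω) (Y ω) :=
    fun ω => ENNReal.tsum_comm
  refine ⟨?_, ?_⟩
  · simp_rw [e]
    exact AEMeasurable.tsum fun n => (h n).1
  · simp_rw [e]
    rw [lintegral_tsum fun n => (h n).1, lintegral_tsum fun n => (hf n).aemeasurable,
      ← ENNReal.tsum_mul_left]
    exact tsum_congr fun n => (h n).2

theorem SatisfiesMecke.const_mul {f : (Config × Θ) × Plane → ℝ≥0∞} (hf : Measurable f)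
    (h : SatisfiesMecke P lam X Y f) (c : ℝ≥0∞) :
    SatisfiesMecke P lam X Y fun q => c * f q := by
  have e : ∀ ω, pointSum (fun q => c * f q) (X ω) (Y ω) = c * pointSum f (X ω) (Y ω) :=
    fun ω => ENNReal.tsum_mul_left
  refine ⟨?_, ?_⟩
  · simp_rw [e]
    exact h.1.const_mul c
  · simp_rw [e]
    rw [lintegral_const_mul'' _ h.1, lintegral_const_mul _ hf, h.2]
    ring

/-- A π-λ argument starting from boxes. The window `C` of finite area keeps both sides finite, so
that the complement step may subtract. -/
theorem satisfiesMecke_indicator_inter [IsProbabilityMeasure P]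
    (hX : IsPoissonProcess P lam fun ω => (X ω).pts)
    (hY : Measurable Y) (hXY : IndepFun X Y P) (hC : MeasurableSet C) (hCv : volume C ≠ ∞)
    {W : Set ((Config × Θ) × Plane)} (hW : MeasurableSet W) :
    SatisfiesMecke P lam X Y ((W ∩ univ ×ˢ C).indicator 1) := by
  have hUC : MeasurableSet ((univ : Set (Config × Θ)) ×ˢ C) := MeasurableSet.univ.prod hC
  have hbox : SatisfiesMecke P lam X Y (((univ : Set (Config × Θ)) ×ˢ C).indicator 1) := by
    have := hX.satisfiesMecke_box hY hXY hC hCv (W := univ) ⟨univ, ⟨univ, univ_mem_voidEvents,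
      univ, by simp, univ_prod_univ⟩, univ, by simp, univ_prod_univ⟩
    rwa [univ_inter] at this
  have := Measure.isProbabilityMeasure_map (μ := P) (hX.measurable.prodMk hY).aemeasurable
  have hfin : ∫⁻ ω, pointSum (((univ : Set (Config × Θ)) ×ˢ C).indicator 1) (X ω) (Y ω) ∂P ≠ ∞ := by
    rw [hbox.2, lintegral_indicator_one hUC, Measure.prod_prod, measure_univ, one_mul]
    exact ENNReal.mul_ne_top (by simp) hCv
  induction W, hW using MeasurableSpace.induction_on_inter (generateFrom_voidBoxes Θ).symm
    (isPiSystem_voidBoxes Θ) with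
  | empty => exact ⟨by simp [pointSum], by simp [pointSum]⟩
  | basic W hW => exact hX.satisfiesMecke_box hY hXY hC hCv hW
  | compl W hW ih =>
    have hadd : ∀ q : (Config × Θ) × Plane, (W ∩ univ ×ˢ C).indicator (1 : (Config × Θ) × Plane → ℝ≥0∞) q +
        (Wᶜ ∩ univ ×ˢ C).indicator (1 : (Config × Θ) × Plane → ℝ≥0∞) q =
        (univ ×ˢ C).indicator (1 : (Config × Θ) × Plane → ℝ≥0∞) q := by
      intro q
      by_cases h1 : q ∈ W <;> by_cases h2 : q.2 ∈ C <;> simp [indicator, h1, h2]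
    have hsum : ∀ ω, pointSum ((W ∩ univ ×ˢ C).indicator 1) (X ω) (Y ω) +
        pointSum ((Wᶜ ∩ univ ×ˢ C).indicator 1) (X ω) (Y ω) =
        pointSum ((univ ×ˢ C).indicator 1) (X ω) (Y ω) := fun ω => by
      rw [pointSum, pointSum, pointSum, ← ENNReal.tsum_add]
      exact tsum_congr fun x => hadd _
    have hfinW : ∫⁻ ω, pointSum ((W ∩ univ ×ˢ C).indicator 1) (X ω) (Y ω) ∂P ≠ ∞ := by
      refine ne_top_of_le_ne_top hfin (lintegral_mono fun ω => ?_)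
      rw [← hsum ω]
      exact le_self_add
    -- Measurability of the sum over points is part of the induction; for the complement it comes
    -- from an almost surely finite difference.
    have hae : AEMeasurable (fun ω => pointSum ((Wᶜ ∩ univ ×ˢ C).indicator 1) (X ω) (Y ω)) P := by
      refine (hbox.1.sub ih.1).congr ?_
      filter_upwards [ae_lt_top' ih.1 hfinW] with ω hω
      rw [Pi.sub_apply, ← hsum ω, ENNReal.add_sub_cancel_left hω.ne]
    refine ⟨hae, ?_⟩
    have h1 := hbox.2
    simp_rw [← hsum] at h1
    rw [lintegral_add_right' _ hae] at h1
    simp_rw [← hadd] at h1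
    rw [lintegral_add_left (measurable_one.indicator (hW.inter hUC)), mul_add, ih.2] at h1
    exact (ENNReal.add_right_inj (ih.2 ▸ hfinW)).1 h1
  | iUnion W hd hW ih =>
    have e : ((⋃ n, W n) ∩ univ ×ˢ C).indicator (1 : (Config × Θ) × Plane → ℝ≥0∞) =
        fun q => ∑' n, (W n ∩ univ ×ˢ C).indicator (1 : (Config × Θ) × Plane → ℝ≥0∞) q := by
      rw [iUnion_inter]
      exact indicator_iUnion_eq_tsum fun i j hij =>
        (hd hij).mono inter_subset_left inter_subset_left
    rw [e]
    exact SatisfiesMecke.tsum (fun n => measurable_one.indicator ((hW n).inter hUC)) ih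

/-- **Mecke's formula** for a Poisson process and an independent random element. -/
theorem satisfiesMecke [IsProbabilityMeasure P]
    (hX : IsPoissonProcess P lam fun ω => (X ω).pts)
    (hY : Measurable Y) (hXY : IndepFun X Y P) {f : (Config × Θ) × Plane → ℝ≥0∞}
    (hf : Measurable f) : SatisfiesMecke P lam X Y f := by
  refine Measurable.ennreal_induction ?_ ?_ ?_ hf
  · intro c s hs
    -- Unit-width annuli partition the plane into windows of finite area.
    let C : ℕ → Set Plane := fun n => {x | ⌊‖x‖⌋₊ = n}
    have hC : ∀ n, MeasurableSet (C n) := fun n =>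
      measurable_norm.nat_floor (measurableSet_singleton n)
    have hCv : ∀ n, volume (C n) ≠ ∞ := fun n => by
      have hsub : C n ⊆ Metric.ball 0 (n + 1) := fun x (hx : ⌊‖x‖⌋₊ = n) => by
        rw [mem_ball_zero_iff, ← hx]
        exact Nat.lt_floor_add_one _
      exact measure_ne_top_of_subset hsub measure_ball_lt_top.ne
    have hsU : s = ⋃ n, s ∩ univ ×ˢ C n := by
      ext q; simp [C]
    have e : (s.indicator fun _ => c) = fun q => c * ∑' n,
        (s ∩ univ ×ˢ C n).indicator (1 : (Config × Θ) × Plane → ℝ≥0∞) q := by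
      have hd : Pairwise fun i j => Disjoint (s ∩ univ ×ˢ C i) (s ∩ univ ×ˢ C j) :=
        fun i j hij => Set.disjoint_left.2 fun q hi hj => hij (hi.2.2.symm.trans hj.2.2)
      ext q
      rw [← congrFun (indicator_iUnion_eq_tsum hd) q, ← hsU]
      simp [indicator]
    have hm : ∀ n, Measurable ((s ∩ univ ×ˢ C n).indicator
        (1 : (Config × Θ) × Plane → ℝ≥0∞)) := fun n =>
      measurable_one.indicator (hs.inter (MeasurableSet.univ.prod (hC n)))
    rw [e]
    exact (SatisfiesMecke.tsum hm fun n =>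
      hX.satisfiesMecke_indicator_inter hY hXY (hC n) (hCv n) hs).const_mul
        (Measurable.tsum hm) c
  · intro f g _ hf hg ihf ihg
    have e : ∀ ω, pointSum (f + g) (X ω) (Y ω) = pointSum f (X ω) (Y ω) + pointSum g (X ω) (Y ω) :=
      fun ω => ENNReal.tsum_add
    refine ⟨?_, ?_⟩
    · simp_rw [e]
      exact ihf.1.add ihg.1
    · simp_rw [e]
      rw [lintegral_add_left' ihf.1, ihf.2, ihg.2, ← mul_add, ← lintegral_add_left hf]
      rfl
  · intro f hf hmono ih
    have e : ∀ ω, pointSum (fun q => ⨆ n, f n q) (X ω) (Y ω) =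
        ⨆ n, pointSum (f n) (X ω) (Y ω) := fun ω => by
      simp only [pointSum, ENNReal.tsum_eq_iSup_sum]
      rw [iSup_comm]
      exact iSup_congr fun s => ENNReal.finsetSum_iSup_of_monotone fun x i j hij => hmono hij _
    refine ⟨?_, ?_⟩
    · simp_rw [e]
      exact AEMeasurable.iSup fun n => (ih n).1
    · simp_rw [e]
      rw [lintegral_iSup' (fun n => (ih n).1) (ae_of_all _ fun ω i j hij =>
        ENNReal.tsum_le_tsum fun x => hmono hij _), lintegral_iSup hf hmono, ENNReal.mul_iSup]
      exact iSup_congr fun n => (ih n).2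

end IsPoissonProcess

/-! ### The law of a Poisson process and its behaviour under similarities -/

theorem Config.map_eq_of_void {Ω Ω' : Type*} [MeasurableSpace Ω] [MeasurableSpace Ω']
    {P : Measure Ω} {P' : Measure Ω'} [IsProbabilityMeasure P] [IsProbabilityMeasure P']
    {X : Ω → Config} {X' : Ω' → Config} (hX : Measurable X) (hX' : Measurable X')
    (h : ∀ D, MeasurableSet D → volume D ≠ ∞ →
      P {ω | (X ω).pts ∩ D = ∅} = P' {ω | (X' ω).pts ∩ D = ∅}) :
    P.map X = P'.map X' := by
  have := Measure.isProbabilityMeasure_map (μ := P) hX.aemeasurable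
  have := Measure.isProbabilityMeasure_map (μ := P') hX'.aemeasurable
  refine ext_of_generate_finite voidEvents generateFrom_voidEvents.symm isPiSystem_voidEvents ?_
    (by simp)
  rintro _ ⟨D, hD, hDv, rfl⟩
  rw [Measure.map_apply hX (Config.measurableSet_void hD),
    Measure.map_apply hX' (Config.measurableSet_void hD)]
  exact h D hD hDv

/-- The similarity of the plane with ratio `c` that maps `0` to `x`. -/
def similarity (c : ℝ) (x z : Plane) : Plane := x + c • z

theorem continuous_similarity (c : ℝ) (x : Plane) : Continuous (similarity c x) := by
  unfold similarity; fun_prop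

theorem similarity_injective {c : ℝ} (hc : c ≠ 0) (x : Plane) :
    Function.Injective (similarity c x) := fun _ _ h => smul_right_injective _ hc (add_left_cancel h)

theorem volume_preimage_similarity {c : ℝ} (hc : c ≠ 0) (x : Plane) (D : Set Plane) :
    volume (similarity c x ⁻¹' D) = ENNReal.ofReal (c ^ 2)⁻¹ * volume D := by
  have : similarity c x ⁻¹' D = (fun z => c • z) ⁻¹' ((fun z => x + z) ⁻¹' D) := rfl
  rw [this, Measure.addHaar_preimage_smul _ hc, measure_preimage_add]
  simp

open scoped Pointwise in
theorem nearerSet_similarity {c : ℝ} (hc : 0 < c) (x : Plane) (S : Set Plane) :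
    similarity c x ⁻¹' nearerSet (similarity c x '' S) x = nearerSet S 0 := by
  ext z
  have h1 : Metric.infEDist (similarity c x z) (similarity c x '' S) =
      ‖c‖ₑ * Metric.infEDist z S := by
    have h2 : similarity c x '' S = (fun z => x + z) '' (c • S) := by
      rw [← image_smul, image_image]; rfl
    rw [h2]
    exact (Metric.infEDist_image (isometry_add_left x)).trans (infEDist_smul₀ hc.ne' S z)
  have h3 : edist (similarity c x z) x = ‖c‖ₑ * edist z 0 := by
    simp [similarity, edist_eq_enorm_sub, enorm_smul]
  change edist (similarity c x z) x < Metric.infEDist (similarity c x z) (similarity c x '' S) ↔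
    edist z 0 < Metric.infEDist z S
  rw [h1, h3]
  exact ENNReal.mul_lt_mul_iff_right (by simpa using hc.ne') (by simp)

/-- The image of a configuration under a similarity. -/
def Config.image (c : ℝ) (x : Plane) (S : Config) : Config := (similarity c x '' S.pts : Set Plane)

theorem Config.pts_image (c : ℝ) (x : Plane) (S : Config) :
    (S.image c x).pts = similarity c x '' S.pts := rfl

theorem Config.measurable_image {c : ℝ} (hc : c ≠ 0) (x : Plane) :
    Measurable (Config.image c x) := by
  refine Config.measurable_iff.2 fun B hB => ?_
  have h : ∀ S : Config, (similarity c x '' S.pts ∩ B).encard =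
      (S.pts ∩ similarity c x ⁻¹' B).encard := fun S => by
    rw [← image_inter_preimage, (similarity_injective hc x).encard_image]
  simp_rw [Config.pts_image, h]
  exact Config.measurable_count (hB.preimage (continuous_similarity c x).measurable)

namespace IsPoissonProcess

variable {Ω Ω' : Type*} [MeasurableSpace Ω] [MeasurableSpace Ω'] {P : Measure Ω} {P' : Measure Ω'}
  [IsProbabilityMeasure P] [IsProbabilityMeasure P'] {lam mu : ℝ≥0}
  {X Y : Ω → Config} {U : Ω' → Config}

/-- Contracting lengths by `√lam` multiplies the density by `lam`. Since void probabilities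
determine the law, only areas of preimages have to be compared. -/
theorem map_eq_map_similarity (hX : IsPoissonProcess P lam fun ω => (X ω).pts)
    (hU : IsPoissonProcess P' 1 fun ω => (U ω).pts) (hlam : 0 < lam) (x : Plane) :
    P.map X = P'.map (Config.image (√lam)⁻¹ x ∘ U) := by
  have hl : (0 : ℝ) < lam := by exact_mod_cast hlam
  have hc : (√(lam : ℝ))⁻¹ ≠ 0 := by positivity
  refine Config.map_eq_of_void hX.measurable
    ((Config.measurable_image hc x).comp hU.measurable) fun D hD hDv => ?_
  have h : ∀ ω, similarity (√lam)⁻¹ x '' (U ω).pts ∩ D = ∅ ↔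
      (U ω).pts ∩ similarity (√lam)⁻¹ x ⁻¹' D = ∅ := fun ω => by
    rw [← image_inter_preimage, image_eq_empty]
  have hv := volume_preimage_similarity hc x D
  have hvf : volume (similarity (√lam)⁻¹ x ⁻¹' D) ≠ ∞ := by
    rw [hv]; exact ENNReal.mul_ne_top (by simp) hDv
  change _ = P' {ω | similarity (√lam)⁻¹ x '' (U ω).pts ∩ D = ∅}
  simp_rw [h]
  rw [hX.measure_void hD hDv,
    hU.measure_void (hD.preimage (continuous_similarity _ x).measurable) hvf, measureReal_def,
    measureReal_def, hv, ENNReal.toReal_mul, ENNReal.toReal_ofReal (by positivity)]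
  simp [Real.sq_sqrt hl.le]

/-- The area of the cell of `x`, in law, is that of the typical cell at unit density divided by the
density. -/
theorem lintegral_comp_volume_nearerSet (hX : IsPoissonProcess P lam fun ω => (X ω).pts)
    (hU : IsPoissonProcess P' 1 fun ω => (U ω).pts) (hlam : 0 < lam) (x : Plane)
    {φ : ℝ≥0∞ → ℝ≥0∞} (hφ : Measurable φ) :
    ∫⁻ ω, φ (volume (nearerSet (X ω).pts x)) ∂P =
      ∫⁻ ω, φ ((lam : ℝ≥0∞)⁻¹ * volume (nearerSet (U ω).pts 0)) ∂P' := by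
  have hl : (0 : ℝ) < lam := by exact_mod_cast hlam
  have hc : 0 < (√(lam : ℝ))⁻¹ := by positivity
  have hm : Measurable fun S : Config => φ (volume (nearerSet S.pts x)) :=
    hφ.comp (measurable_volume_nearerSet x)
  rw [← lintegral_map hm hX.measurable, hX.map_eq_map_similarity hU hlam x,
    lintegral_map hm ((Config.measurable_image hc.ne' x).comp hU.measurable)]
  refine lintegral_congr fun ω => congrArg φ ?_
  change volume (nearerSet (similarity (√lam)⁻¹ x '' (U ω).pts) x) = _
  rw [← nearerSet_similarity hc x, volume_preimage_similarity hc.ne', ← mul_assoc]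
  have : (lam : ℝ≥0∞)⁻¹ * ENNReal.ofReal ((√(lam : ℝ))⁻¹ ^ 2)⁻¹ = 1 := by
    rw [inv_pow, Real.sq_sqrt hl.le, inv_inv, ENNReal.ofReal_coe_nnreal]
    exact ENNReal.inv_mul_cancel (by simpa using hlam.ne') (by simp)
  rw [this, one_mul]

theorem ae_volume_nearerSet_lt_top (hX : IsPoissonProcess P lam fun ω => (X ω).pts)
    (hlam : 0 < lam) (x : Plane) : ∀ᵐ ω ∂P, volume (nearerSet (X ω).pts x) < ∞ :=
  ae_lt_top ((measurable_volume_nearerSet x).comp hX.measurable) (by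
    rw [hX.lintegral_volume_nearerSet hlam]
    simpa using hlam.ne')

/-- Independence allows the cell to be frozen by fixing `Y`. Its area is almost surely finite, so
the void probability formula for `X` applies; scaling then replaces `Y` by the unit-density process.
-/
theorem measure_inter_nearerSet_eq_empty (hX : IsPoissonProcess P lam fun ω => (X ω).pts)
    (hY : IsPoissonProcess P mu fun ω => (Y ω).pts) (hmu : 0 < mu) (hXY : IndepFun X Y P)
    (hU : IsPoissonProcess P' 1 fun ω => (U ω).pts) (x : Plane) :
    P {ω | (X ω).pts ∩ nearerSet (Y ω).pts x = ∅} =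
      ∫⁻ ω, ENNReal.ofReal (Real.exp
        (-((lam : ℝ) / mu) * (volume (nearerSet (U ω).pts 0)).toReal)) ∂P' := by
  have hW : MeasurableSet {q : Config × Config | q.1.pts ∩ nearerSet q.2.pts x = ∅} := by
    have := (measurable_encard_inter_nearerSet.comp
      (f := fun q : Config × Config => (q, x)) (by fun_prop)) (measurableSet_singleton 0)
    simpa [preimage] using this
  have h1 : P {ω | (X ω).pts ∩ nearerSet (Y ω).pts x = ∅} =
      (P.map fun ω => (X ω, Y ω)) {q | q.1.pts ∩ nearerSet q.2.pts x = ∅} :=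
    (Measure.map_apply (hX.measurable.prodMk hY.measurable) hW).symm
  have := Measure.isProbabilityMeasure_map (μ := P) hX.measurable.aemeasurable
  have := Measure.isProbabilityMeasure_map (μ := P) hY.measurable.aemeasurable
  have hφ : Measurable fun a : ℝ≥0∞ => ENNReal.ofReal (Real.exp (-(lam * a.toReal))) := by
    fun_prop
  rw [h1, (indepFun_iff_map_prod_eq_prod_map_map hX.measurable.aemeasurable
    hY.measurable.aemeasurable).1 hXY, Measure.prod_apply_symm hW,
    lintegral_map (measurable_measure_prodMk_right hW) hY.measurable]
  calc _ = ∫⁻ ω, ENNReal.ofReal (Real.exp (-(lam * (volume (nearerSet (Y ω).pts x)).toReal))) ∂P := by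
        refine lintegral_congr_ae ?_
        filter_upwards [hY.ae_volume_nearerSet_lt_top hmu x] with ω hω
        have ho := (isOpen_nearerSet (Y ω).pts x).measurableSet
        have e : (fun S : Config => (S, Y ω)) ⁻¹'
            {q : Config × Config | q.1.pts ∩ nearerSet q.2.pts x = ∅} =
            {S : Config | S.pts ∩ nearerSet (Y ω).pts x = ∅} := rfl
        rw [e, Measure.map_apply hX.measurable (Config.measurableSet_void ho)]
        exact hX.measure_void ho hω.ne
    _ = _ := hY.lintegral_comp_volume_nearerSet hU hmu x hφ
    _ = _ := by
        refine lintegral_congr fun ω => ?_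
        rw [ENNReal.toReal_mul, ENNReal.toReal_inv, ENNReal.coe_toReal, div_eq_mul_inv]
        ring_nf

/-- The mean number of points of a Poisson process in a cell of an independent one. -/
theorem lintegral_encard_inter_nearerSet (hX : IsPoissonProcess P lam fun ω => (X ω).pts)
    (hY : IsPoissonProcess P mu fun ω => (Y ω).pts) (hmu : 0 < mu) (hXY : IndepFun X Y P)
    (x : Plane) :
    ∫⁻ ω, (((X ω).pts ∩ nearerSet (Y ω).pts x).encard : ℝ≥0∞) ∂P = ((lam / mu : ℝ≥0) : ℝ≥0∞) := by
  have hW : MeasurableSet {q : (Config × Config) × Plane | q.2 ∈ nearerSet q.1.2.pts x} :=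
    measurableSet_mem_nearerSet.preimage
      (f := fun q : (Config × Config) × Plane => ((q.1.2, x), q.2)) (by fun_prop)
  have h := (hX.satisfiesMecke hY.measurable hXY (measurable_one.indicator hW)).2
  simp_rw [pointSum_indicator_one] at h
  have hms : Measurable fun ω => (X ω, Y ω) := hX.measurable.prodMk hY.measurable
  have := Measure.isProbabilityMeasure_map (μ := P) hms.aemeasurable
  rw [lintegral_indicator_one hW, Measure.prod_apply hW,
    lintegral_map (measurable_measure_prodMk_left hW) hms] at h
  refine h.trans ?_
  change _ * ∫⁻ ω, volume (nearerSet (Y ω).pts x) ∂P = _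
  rw [hY.lintegral_volume_nearerSet hmu, ENNReal.coe_div hmu.ne', div_eq_mul_inv]

/-- A fixed point is almost surely at positive distance from `Y`; Mecke's formula extends this to
all points of `X` at once. It excludes links of length zero to an eavesdropper, where `g` is
unconstrained. -/
theorem ae_forall_infEDist_pos (hX : IsPoissonProcess P lam fun ω => (X ω).pts)
    (hY : IsPoissonProcess P mu fun ω => (Y ω).pts) (hmu : 0 < mu) (hXY : IndepFun X Y P) :
    ∀ᵐ ω ∂P, ∀ x ∈ (X ω).pts, 0 < Metric.infEDist x (Y ω).pts := by
  have hW : MeasurableSet {q : (Config × Config) × Plane | Metric.infEDist q.2 q.1.2.pts = 0} :=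
    (measurable_infEDist_config.comp (f := fun q : (Config × Config) × Plane => (q.1.2, q.2))
      (by fun_prop)) (measurableSet_singleton 0)
  have h := hX.satisfiesMecke hY.measurable hXY (measurable_one.indicator hW)
  have hms : Measurable fun ω => (X ω, Y ω) := hX.measurable.prodMk hY.measurable
  have := Measure.isProbabilityMeasure_map (μ := P) hms.aemeasurable
  have h0 : ∫⁻ q, {q : (Config × Config) × Plane | Metric.infEDist q.2 q.1.2.pts = 0}.indicator 1 q
      ∂((P.map fun ω => (X ω, Y ω)).prod volume) = 0 := by
    rw [lintegral_indicator_one hW, Measure.prod_apply_symm hW]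
    refine lintegral_eq_zero_of_ae_eq_zero (ae_of_all _ fun x => ?_)
    beta_reduce
    rw [Measure.map_apply hms (measurable_prodMk_right hW)]
    refine measure_mono_null (fun ω hω => ?_) (hY.ae_infEDist_pos hmu x)
    exact not_lt.2 (le_of_eq hω)
  have h2 := h.2
  rw [h0, mul_zero, lintegral_eq_zero_iff' h.1] at h2
  filter_upwards [h2] with ω hω x hx
  simp only [pointSum_indicator_one, Pi.zero_apply] at hω
  rw [pos_iff_ne_zero]
  intro hx0
  have hem : {x ∈ (X ω).pts | Metric.infEDist x (Y ω).pts = 0} = ∅ := by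
    simpa using hω
  exact (hem ▸ ⟨hx, hx0⟩ : x ∈ (∅ : Set Plane))

end IsPoissonProcess

/-! ### The secure communications graph with path loss only -/

theorem voronoiCell_insert {S : Set Plane} (hS : IsClosed S) {x : Plane} (hx : x ∉ S) :
    voronoiCell (insert x S) x = nearerSet S x := by
  ext y
  rw [hS.mem_nearerSet_iff]
  refine ⟨fun h z hz => h z (mem_insert_of_mem _ hz) fun h => hx (h ▸ hz), fun h z hz hzx => ?_⟩
  exact h z (hz.resolve_left hzx)

theorem IsPathLossGain.pos {g : ℝ → ℝ} (hg : IsPathLossGain g) {r : ℝ} (hr : 0 < r) : 0 < g r := by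
  have h1 : g (r + 1) < g r := hg.strictAntiOn hr (by simp; linarith) (by linarith)
  refine lt_of_le_of_lt ?_ h1
  refine le_of_tendsto hg.tendsto_zero ?_
  filter_upwards [eventually_ge_atTop (r + 1)] with s hs
  exact hg.strictAntiOn.antitoneOn (by simp; linarith) (by simp; linarith) hs

theorem maxSecrecyRate_pathLoss_pos_iff {p σ2 : ℝ} (hp : 0 < p) (hσ2 : 0 < σ2) {g : ℝ → ℝ}
    (hg : IsPathLossGain g) {x y e : Plane} (hxy : x ≠ y) (hxe : x ≠ e) :
    0 < maxSecrecyRate (pathLossPower p g) σ2 σ2 x y e ↔ dist x y < dist x e := by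
  have hy := dist_pos.2 hxy
  have he := dist_pos.2 hxe
  have hgy := hg.pos hy
  have hge := hg.pos he
  rw [maxSecrecyRate, lt_max_iff, sub_pos, pathLossPower, pathLossPower,
    Real.logb_lt_logb_iff one_lt_two (by positivity) (by positivity), add_lt_add_iff_left,
    div_lt_div_iff_of_pos_right hσ2, mul_lt_mul_iff_right₀ hp, hg.strictAntiOn.lt_iff_gt he hy]
  simp

/-- The eavesdropper receiving the most power is a nearest one. It exists because `E` is closed and
nonempty; for empty `E` the graph has no edges, while `nearerSet` is the whole plane. -/
theorem iSGraph_pathLoss_adj_iff {p σ2 : ℝ} (hp : 0 < p) (hσ2 : 0 < σ2) {g : ℝ → ℝ}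
    (hg : IsPathLossGain g) {L E : Set Plane} (hE : IsClosed E) (hne : E.Nonempty) {x y : Plane}
    (hx : x ∉ E) :
    (iSGraph (pathLossPower p g) σ2 σ2 0 L E).Adj x y ↔
      x ∈ L ∧ y ∈ L ∧ x ≠ y ∧ x ∈ nearerSet E y := by
  refine and_congr_right fun _ => and_congr_right fun _ => and_congr_right fun hxy => ?_
  rw [hE.mem_nearerSet_iff]
  have hxE : ∀ e ∈ E, x ≠ e := fun e he h => hx (h ▸ he)
  have hpow : ∀ e ∈ E, ∀ e' ∈ E,
      (pathLossPower p g x e' ≤ pathLossPower p g x e ↔ dist x e ≤ dist x e') :=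
    fun e he e' he' => by
      rw [pathLossPower, pathLossPower, mul_le_mul_iff_right₀ hp, hg.strictAntiOn.le_iff_ge
        (dist_pos.2 (hxE e' he')) (dist_pos.2 (hxE e he))]
  constructor
  · rintro ⟨e, he, hmax, hpos⟩ e' he'
    rw [maxSecrecyRate_pathLoss_pos_iff hp hσ2 hg hxy (hxE e he)] at hpos
    exact hpos.trans_le ((hpow e he e' he').1 (hmax he'))
  · intro h
    obtain ⟨e, he, hd⟩ := hE.exists_infDist_eq_dist hne x
    refine ⟨e, he, fun e' he' => (hpow e he e' he').2 ?_,
      (maxSecrecyRate_pathLoss_pos_iff hp hσ2 hg hxy (hxE e he)).2 (h e he)⟩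
    rw [← hd]
    exact Metric.infDist_le_dist_of_mem he'

theorem setOf_adj_eq {p σ2 : ℝ} (hp : 0 < p) (hσ2 : 0 < σ2) {g : ℝ → ℝ}
    (hg : IsPathLossGain g) {L E : Set Plane} (hE : IsClosed E) (hne : E.Nonempty) {y : Plane}
    (hy : y ∈ L) (hL : ∀ x ∈ L, x ≠ y → x ∉ E) :
    {x | (iSGraph (pathLossPower p g) σ2 σ2 0 L E).Adj x y} = (L \ {y}) ∩ nearerSet E y := by
  ext x
  constructor
  · intro h
    have h' : (iSGraph (pathLossPower p g) σ2 σ2 0 L E).Adj x y := h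
    have := (iSGraph_pathLoss_adj_iff hp hσ2 hg hE hne (hL x h'.1 h'.2.2.1)).1 h'
    exact ⟨⟨this.1, this.2.2.1⟩, this.2.2.2⟩
  · rintro ⟨⟨h1, h2⟩, h3⟩
    exact (iSGraph_pathLoss_adj_iff hp hσ2 hg hE hne (hL x h1 h2)).2 ⟨h1, hy, h2, h3⟩

theorem inIsolated_iff {G : Digraph Plane} {y : Plane} : InIsolated G y ↔ {x | G.Adj x y} = ∅ :=
  eq_empty_iff_forall_notMem.symm

theorem tsum_inter_eq_pointSum {Θ : Type*} (B : Set Plane) (S : Config) (θ : Θ)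
    (F : Plane → ℝ≥0∞) (f : (Config × Θ) × Plane → ℝ≥0∞)
    (h : ∀ x ∈ S.pts, F x = f ((S.erase x, θ), x)) :
    ∑' x : ↥(S.pts ∩ B), F x =
      pointSum ((univ ×ˢ B).indicator f) S θ := by
  rw [pointSum, tsum_subtype _ F, tsum_subtype S.pts
    (fun x => ((univ : Set (Config × Θ)) ×ˢ B).indicator f ((S.erase x, θ), x))]
  refine tsum_congr fun x => ?_
  by_cases h1 : x ∈ S.pts <;> by_cases h2 : x ∈ B <;> simp [h1, h2, indicator, h x]

/-! ### Palm means and the assembly of the theorem. -/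

section

variable {Ω : Type*} [MeasurableSpace Ω] {P : Measure Ω} [IsProbabilityMeasure P]
  {lamL : ℝ≥0} {L E : Ω → Config}

/-- The Palm mean of a quantity that is almost surely a function of the other points, an
independent process and the point itself. -/
theorem hasPalmMean_of_forall_lintegral (hlamL : 0 < lamL)
    (hL : IsPoissonProcess P lamL fun ω => (L ω).pts) (hE : Measurable E) (hLE : IndepFun L E P)
    {F : Ω → Plane → ℝ≥0∞} {f : (Config × Config) × Plane → ℝ≥0∞} (hf : Measurable f) {v : ℝ≥0∞}
    (hF : ∀ᵐ ω ∂P, ∀ x ∈ (L ω).pts, F ω x = f (((L ω).erase x, E ω), x))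
    (hv : ∀ x, ∫⁻ ω, f ((L ω, E ω), x) ∂P = v) :
    HasPalmMean P lamL (fun ω => (L ω).pts) F v := by
  intro B hB hB0 hBt
  have hm : Measurable ((univ ×ˢ B).indicator f) := hf.indicator (MeasurableSet.univ.prod hB)
  have h := hL.satisfiesMecke hE hLE hm
  have hms : Measurable fun ω => (L ω, E ω) := hL.measurable.prodMk hE
  have := Measure.isProbabilityMeasure_map (μ := P) hms.aemeasurable
  have hae : (fun ω => ∑' x : ↥((L ω).pts ∩ B), F ω x) =ᵐ[P]
      fun ω => pointSum ((univ ×ˢ B).indicator f) (L ω) (E ω) := by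
    filter_upwards [hF] with ω hω using tsum_inter_eq_pointSum B (L ω) (E ω) (F ω) f hω
  refine ⟨h.1.congr hae.symm, ?_⟩
  have hint : ∀ x, ∫⁻ q, ((univ ×ˢ B).indicator f) (q, x) ∂(P.map fun ω => (L ω, E ω)) =
      B.indicator (fun _ => v) x := by
    intro x
    have hmx : Measurable fun q => ((univ ×ˢ B).indicator f) (q, x) :=
      hm.comp measurable_prodMk_right
    rw [lintegral_map hmx hms]
    by_cases hx : x ∈ B
    · simp [hx, indicator, hv]
    · simp [hx, indicator]
  rw [lintegral_congr_ae hae, h.2, lintegral_prod_symm _ hm.aemeasurable]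
  simp_rw [hint]
  rw [lintegral_indicator hB, setLIntegral_const, mul_comm v, ← mul_assoc, mul_comm,
    mul_div_assoc, ENNReal.div_self, mul_one]
  · exact mul_ne_zero (by simpa using hlamL.ne') hB0
  · exact ENNReal.mul_ne_top (by simp) hBt

end

/-- The theorem for configuration-valued random elements. -/
theorem poissonGraph_in_degree_and_isolation
    {Ω : Type*} [MeasurableSpace Ω] (P : Measure Ω) [IsProbabilityMeasure P]
    (lamL lamE : ℝ≥0) (hlamL : 0 < lamL) (hlamE : 0 < lamE)
    (L E : Ω → Config)
    (hL : IsPoissonProcess P lamL fun ω => (L ω).pts)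
    (hE : IsPoissonProcess P lamE fun ω => (E ω).pts)
    (hLE : IndepFun L E P)
    (p σ2 : ℝ) (hp : 0 < p) (hσ2 : 0 < σ2) (g : ℝ → ℝ) (hg : IsPathLossGain g)
    {Ω' : Type*} [MeasurableSpace Ω'] (P' : Measure Ω') [IsProbabilityMeasure P']
    (U : Ω' → Config) (hU : IsPoissonProcess P' 1 fun ω => (U ω).pts) :
    (AEMeasurable (fun ω => typicalCellArea (U ω).pts) P' ∧
      ∫⁻ ω, typicalCellArea (U ω).pts ∂P' = 1) ∧
    (HasPalmMean P lamL (fun ω => (L ω).pts)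
        (fun ω x =>
          (inDegree (iSGraph (pathLossPower p g) σ2 σ2 0 (L ω).pts (E ω).pts) x : ℝ≥0∞))
        ((lamL / lamE : ℝ≥0) : ℝ≥0∞) ∧
      HasPalmMean P lamL (fun ω => (L ω).pts)
        (fun ω => {x | InIsolated
          (iSGraph (pathLossPower p g) σ2 σ2 0 (L ω).pts (E ω).pts) x}.indicator 1)
        (ENNReal.ofReal
          (∫ ω, Real.exp (-((lamL : ℝ) / lamE) * (typicalCellArea (U ω).pts).toReal) ∂P'))) ∧
    (AEMeasurable (fun ω =>
        inDegree (iSGraph (pathLossPower p g) σ2 σ2 0 (insert 0 (L ω).pts) (E ω).pts) 0) P ∧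
      ∫⁻ ω, (inDegree
          (iSGraph (pathLossPower p g) σ2 σ2 0 (insert 0 (L ω).pts) (E ω).pts) 0 : ℝ≥0∞) ∂P
        = ((lamL / lamE : ℝ≥0) : ℝ≥0∞) ∧
      P {ω | InIsolated
          (iSGraph (pathLossPower p g) σ2 σ2 0 (insert 0 (L ω).pts) (E ω).pts) 0}
        = ENNReal.ofReal
          (∫ ω, Real.exp (-((lamL : ℝ) / lamE) * (typicalCellArea (U ω).pts).toReal) ∂P')) := by
  have hcell : (fun ω => typicalCellArea (U ω).pts) =ᵐ[P']
      fun ω => volume (nearerSet (U ω).pts 0) := by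
    filter_upwards [hU.ae_isClosed, hU.ae_notMem 0] with ω h1 h2
    rw [typicalCellArea, voronoiCell_insert h1 h2]
  have hcellm : AEMeasurable (fun ω => typicalCellArea (U ω).pts) P' :=
    ((measurable_volume_nearerSet 0).comp hU.measurable).aemeasurable.congr hcell.symm
  have hval : ∀ x, P {ω | (L ω).pts ∩ nearerSet (E ω).pts x = ∅} = ENNReal.ofReal
      (∫ ω, Real.exp (-((lamL : ℝ) / lamE) * (typicalCellArea (U ω).pts).toReal) ∂P') := by
    intro x
    rw [hL.measure_inter_nearerSet_eq_empty hE hlamE hLE hU x, ofReal_integral_eq_lintegral_ofReal]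
    · refine lintegral_congr_ae ?_
      filter_upwards [hcell] with ω hω
      rw [hω]
    · refine Integrable.of_bound (C := 1) ?_ (ae_of_all _ fun ω => ?_)
      · exact (Real.measurable_exp.comp_aemeasurable
          (hcellm.ennreal_toReal.const_mul _)).aestronglyMeasurable
      · rw [Real.norm_of_nonneg (Real.exp_nonneg _), Real.exp_le_one_iff, neg_mul, neg_nonpos]
        positivity
    · exact ae_of_all _ fun ω => Real.exp_nonneg _
  have hnotMem : ∀ᵐ ω ∂P, ∀ x ∈ (L ω).pts, x ∉ (E ω).pts := by
    filter_upwards [hL.ae_forall_infEDist_pos hE hlamE hLE] with ω hω x hx hxE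
    exact (hω x hx).ne' (Metric.infEDist_zero_of_mem hxE)
  -- The in-neighbours depend on `L` only through the configuration with `x` erased, which is the
  -- form that Mecke's formula requires.
  have hpalm : ∀ᵐ ω ∂P, ∀ x ∈ (L ω).pts,
      {y | (iSGraph (pathLossPower p g) σ2 σ2 0 (L ω).pts (E ω).pts).Adj y x} =
        ((L ω).erase x).pts ∩ nearerSet (E ω).pts x := by
    filter_upwards [hE.ae_isClosed, hE.ae_nonempty hlamE, hnotMem] with ω h1 h2 h3 x hx
    exact setOf_adj_eq hp hσ2 hg h1 h2 hx fun y hy _ => h3 y hy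
  have horigin : ∀ᵐ ω ∂P,
      {y | (iSGraph (pathLossPower p g) σ2 σ2 0 (insert 0 (L ω).pts) (E ω).pts).Adj y 0} =
        (L ω).pts ∩ nearerSet (E ω).pts 0 := by
    filter_upwards [hE.ae_isClosed, hE.ae_nonempty hlamE, hnotMem, hL.ae_notMem 0] with ω h1 h2 h3 h4
    rw [setOf_adj_eq hp hσ2 hg h1 h2 (mem_insert _ _) fun y hy hy0 => h3 y (hy.resolve_left hy0),
      insert_sdiff_self_of_notMem h4]
  have hmeas := measurable_encard_inter_nearerSet
  have hmeasE : Measurable fun q : (Config × Config) × Plane =>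
      ((q.1.1.pts ∩ nearerSet q.1.2.pts q.2).encard : ℝ≥0∞) :=
    (Measurable.of_discrete (f := fun n : ℕ∞ => (n : ℝ≥0∞))).comp hmeas
  have hmeasI : MeasurableSet {q : (Config × Config) × Plane |
      q.1.1.pts ∩ nearerSet q.1.2.pts q.2 = ∅} := by
    simpa [preimage] using hmeas (measurableSet_singleton 0)
  refine ⟨⟨hcellm, ?_⟩, ⟨?_, ?_⟩, ?_, ?_, ?_⟩
  · rw [lintegral_congr_ae hcell, hU.lintegral_volume_nearerSet one_pos]
    simp
  · refine hasPalmMean_of_forall_lintegral hlamL hL hE.measurable hLE hmeasE ?_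
      (hL.lintegral_encard_inter_nearerSet hE hlamE hLE)
    filter_upwards [hpalm] with ω hω x hx
    rw [inDegree, hω x hx]
  · refine hasPalmMean_of_forall_lintegral hlamL hL hE.measurable hLE
      (measurable_one.indicator hmeasI) ?_ fun x => ?_
    · filter_upwards [hpalm] with ω hω x hx
      simp only [indicator, mem_ofPred_eq, inIsolated_iff, hω x hx, Pi.one_apply]
    · rw [← hval x, ← lintegral_indicator_one]
      · rfl
      · exact hmeasI.preimage ((hL.measurable.prodMk hE.measurable).prodMk measurable_const)
  · refine AEMeasurable.congr (f := fun ω => ((L ω).pts ∩ nearerSet (E ω).pts 0).encard)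
      (hmeas.comp ((hL.measurable.prodMk hE.measurable).prodMk measurable_const)).aemeasurable ?_
    filter_upwards [horigin] with ω hω
    rw [inDegree, hω]
  · rw [← hL.lintegral_encard_inter_nearerSet hE hlamE hLE 0]
    refine lintegral_congr_ae ?_
    filter_upwards [horigin] with ω hω
    rw [inDegree, hω]
  · rw [← hval 0]
    refine measure_congr ?_
    filter_upwards [horigin] with ω hω
    refine propext ?_
    change InIsolated _ _ ↔ (L ω).pts ∩ nearerSet (E ω).pts 0 = ∅
    rw [inIsolated_iff, hω]

/-- The σ-algebra of `Config` unfolds to `countSigmaAlgebra`, so both notions of independence agree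
definitionally. -/
theorem IndepPointProcesses.indepFun {Ω : Type*} [MeasurableSpace Ω] {P : Measure Ω}
    {X Y : Ω → Config} (h : IndepPointProcesses P (fun ω => (X ω).pts) fun ω => (Y ω).pts) :
    IndepFun X Y P := by
  rw [IndepFun_iff_Indep]
  exact h

theorem mainTheorem2
    -- the Poisson graph: independent legitimate nodes and eavesdroppers
    {Ω : Type*} [MeasurableSpace Ω] (P : Measure Ω) [IsProbabilityMeasure P]
    (lamL lamE : ℝ≥0) (hlamL : 0 < lamL) (hlamE : 0 < lamE)
    (PiL PiE : Ω → Set Plane)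
    (hPiL : IsPoissonProcess P lamL PiL) (hPiE : IsPoissonProcess P lamE PiE)
    (hindep : IndepPointProcesses P PiL PiE)
    -- transmit power, common noise power and gain function; path loss only, threshold `0`
    (p σ2 : ℝ) (hp : 0 < p) (hσ2 : 0 < σ2) (g : ℝ → ℝ) (hg : IsPathLossGain g)
    -- a Poisson process of unit density, with the area of its typical Voronoi cell
    {Ω' : Type*} [MeasurableSpace Ω'] (P' : Measure Ω') [IsProbabilityMeasure P']
    (PiU : Ω' → Set Plane) (hPiU : IsPoissonProcess P' 1 PiU) :
    -- the typical cell of a unit-density process has mean area one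
    (AEMeasurable (fun ω => typicalCellArea (PiU ω)) P' ∧
      ∫⁻ ω, typicalCellArea (PiU ω) ∂P' = 1) ∧
    -- mean in-degree and in-isolation probability of the typical node, in the sense of Palm
    (HasPalmMean P lamL PiL
        (fun ω x =>
          (inDegree (iSGraph (pathLossPower p g) σ2 σ2 0 (PiL ω) (PiE ω)) x : ℝ≥0∞))
        ((lamL / lamE : ℝ≥0) : ℝ≥0∞) ∧
      HasPalmMean P lamL PiL
        (fun ω => {x | InIsolated
          (iSGraph (pathLossPower p g) σ2 σ2 0 (PiL ω) (PiE ω)) x}.indicator 1)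
        (ENNReal.ofReal
          (∫ ω, Real.exp (-((lamL : ℝ) / lamE) * (typicalCellArea (PiU ω)).toReal) ∂P'))) ∧
    -- the same for the node at the origin in the process of legitimate nodes with `0` added
    (AEMeasurable (fun ω =>
        inDegree (iSGraph (pathLossPower p g) σ2 σ2 0 (insert 0 (PiL ω)) (PiE ω)) 0) P ∧
      ∫⁻ ω, (inDegree
          (iSGraph (pathLossPower p g) σ2 σ2 0 (insert 0 (PiL ω)) (PiE ω)) 0 : ℝ≥0∞) ∂P
        = ((lamL / lamE : ℝ≥0) : ℝ≥0∞) ∧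
      P {ω | InIsolated
          (iSGraph (pathLossPower p g) σ2 σ2 0 (insert 0 (PiL ω)) (PiE ω)) 0}
        = ENNReal.ofReal
          (∫ ω, Real.exp (-((lamL : ℝ) / lamE) * (typicalCellArea (PiU ω)).toReal) ∂P')) := by
  exact poissonGraph_in_degree_and_isolation P lamL lamE hlamL hlamE PiL PiE hPiL hPiE
    (IndepPointProcesses.indepFun hindep) p σ2 hp hσ2 g hg P' PiU hPiU
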